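/- **Setting.** Let $\mathbb R^n$ carry an arbitrary norm $\|\cdot\|$ and let $m\ge 1$. Consider $$\Psi^*=\min_{x\in X}\Big\{\Psi(x)=\sum_{i=1}^m f_i(x)+h(x)+\mu\,\omega(x)\Big\},\qquad f_i(x)=\max_{y_i\in Y_i}\langle A_ix,y_i\rangle-q_i(y_i),$$ where $X\subseteq\mathbb R^n$ is closed and convex, $h:X\to\mathbb R$ is convex, $\omega:X\to\mathbb R$ is strongly convex with modulus $1$ w.r.t. $\|\cdot\|$, $\mu>0$, the sets $Y_i$ are nonempty convex subsets of finite-dimensional normed spaces, $q_i:Y_i\to\mathbb R$ is convex, and $A_i$ is linear with operator norm $\|A_i\|$. Let $v_i:Y_i\to\mathbb R$ be strongly convex with modulus $1$ and $0\le v_i\le\Omega_{Y_i}^2$ on $Y_i$. Put $\|A\|^2=\sum_i\|A_i\|^2$ and $\Omega_Y^2=\sum_i\Omega_{Y_i}^2$ (with $\|A\|,\Omega_Y\ge 0$). For $\delta>0$ let $$\tilde f_i(x,\delta)=\max_{y_i\in Y_i}\langle A_ix,y_i\rangle-q_i(y_i)-\delta v_i(y_i),\qquad \tilde\Psi_\delta^*=\min_{x\in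 X}\Big\{\sum_i\tilde f_i(x,\delta)+h(x)+\mu\,\omega(x)\Big\}.$$ The maxima over $Y_i$ and the minimum defining $\tilde\Psi^*_\delta$ are assumed to be attained ($\Psi^*$ may be read as an infimum). Let $x^0\in X$ and $\omega'(x^0)\in\partial\omega(x^0)$, write $P(x^0,x)=\omega(x)-\omega(x^0)-\langle\omega'(x^0),x-x^0\rangle$, and let $\Omega_X\ge0$ satisfy $P(x^0,x)\le\Omega_X^2$ for all $x\in X$. **Method.** Let $\varepsilon>0$, $\delta=\varepsilon/(2\Omega_Y^2)$, $\tilde L_i=\|A_i\|^2/\delta$, $\tilde L=\sum_i\tilde L_i$, $C=8\tilde L/\mu$, $r=\sqrt{(m-1)^2+4mC}$, and $$p_i=\frac1{2m}+\frac{\tilde L_i}{2\tilde L},\quad \tau=\frac{r-(m-1)}{2m},\quad \eta=\frac{\mu r+\mu(m-1)}2,\quad \alpha=1-\frac1{m+1+r}.$$ The RPDG method starts with $x^{-1}=x^0$, $\underline x_i^0=x^0$, $y_i^0=\nabla\tilde f_i(x^0,\delta)$. In iteration $t=1,2,\dots$ it draws an index $i_t$, independently of the previous ones, with $\mathrm{Prob}\{i_t=i\}=p_i$,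 sets $\tilde x^t=\alpha(x^{t-1}-x^{t-2})+x^{t-1}$, $\underline x_{i_t}^t=(\tilde x^t+\tau\underline x_{i_t}^{t-1})/(1+\tau)$, $y_{i_t}^t=\nabla\tilde f_{i_t}(\underline x_{i_t}^t,\delta)$, leaves $\underline x_i^t=\underline x_i^{t-1}$ and $y_i^t=y_i^{t-1}$ for $i\ne i_t$, and computes $$x^t=\operatorname*{argmin}_{x\in X}\ \langle g,x\rangle+h(x)+\mu\,\omega(x)+\eta P(x^{t-1},x),\qquad g=\sum_iy_i^{t-1}+p_{i_t}^{-1}(y_{i_t}^t-y_{i_t}^{t-1}),$$ together with subgradients $h'(x^t)\in\partial h(x^t)$ and $\omega'(x^t)\in\partial\omega(x^t)$ such that $\langle g+h'(x^t)+(\mu+\eta)\omega'(x^t)-\eta\,\omega'(x^{t-1}),x-x^t\rangle\ge0$ for all $x\in X$; this $\omega'(x^t)$ defines $P(x^t,\cdot)$. This prox-mapping is assumed to be computable: a fixed procedure returns such $x^t$ and $\omega'(x^t)$ for every $g\in\mathbb R^n$, $x^{t-1}\in X$ and $\omega'(x^{t-1})\in\partial\omega(x^{t-1})$. The output after $k$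 iterations is $\bar x^k=\big(\sum_{t=1}^k\alpha^{-t}\big)^{-1}\sum_{t=1}^k\alpha^{-t}x^t$. **Proposition 4.2.** There is an absolute constant $c>0$ such that the following holds in every such setting, for every $\varepsilon>0$ that is small in the sense that $$\varepsilon\le\min\Big\{\frac{\|A\|^2\Omega_Y^2}{m\mu},\ \frac{m\Omega_X^2}{\mu},\ \frac{m\|A\|\Omega_X\Omega_Y}{\mu\max\{2,\mu\}}\Big\}.$$ (a) There is an integer $K\ge1$ with $$K\le c\,\|A\|\Omega_Y\sqrt{\frac m{\mu\varepsilon}}\,\log\frac{m\|A\|\Omega_X\Omega_Y}{\mu\varepsilon}$$ such that for every $k\ge K$ the output satisfies $\bar x^k\in X$ and $\mathbb E[\Psi(\bar x^k)-\Psi^*]\le\varepsilon$. (b) For every $\lambda\in(0,1)$ there is an integer $K\ge1$ with $$K\le c\,\|A\|\Omega_Y\sqrt{\frac m{\mu\varepsilon}}\,\log\frac{m\|A\|\Omega_X\Omega_Y}{\lambda\mu\varepsilon}$$ such that for every $k\ge K$ the output satisfies $\bar x^k\in X$ and $\mathrm{Prob}\{\Psi(\bar x^k)-\Psi^*>\varepsilon\}\le\lambda$.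 -/

import Mathlib

open MeasureTheory ProbabilityTheory

noncomputable section

namespace RPDG

/-- `s` is a subgradient at `x` of the function `φ : X → ℝ`. -/
def IsSubgradOn {E : Type*} [NormedAddCommGroup E] [NormedSpace ℝ E]
    (φ : E → ℝ) (X : Set E) (x : E) (s : StrongDual ℝ E) : Prop :=
  x ∈ X ∧ ∀ z ∈ X, φ x + s (z - x) ≤ φ z

/-- The primal prox-function `P(x₀, x)` of `ω`, for the chosen subgradient `s₀` of `ω` at `x₀`. -/
def proxFun {E : Type*} [NormedAddCommGroup E] [NormedSpace ℝ E]
    (ω : E → ℝ) (x₀ : E) (s₀ : StrongDual ℝ E) (x : E) : ℝ :=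
  ω x - (ω x₀ + s₀ (x - x₀))

/-! ### The randomized primal-dual gradient method -/

/-- `x₁` is the value of the prox-mapping
`argmin {⟨g, x⟩ + h x + μ ω x + η P(x₀, x) : x ∈ X}`, and `s₁` is the subgradient of `ω` at `x₁`
which is selected through the optimality condition of this problem:
`⟨g + h'(x₁) + (μ + η) s₁ - η s₀, x - x₁⟩ ≥ 0` on `X` for some subgradient `h'(x₁)`. -/
structure IsProxStep {E : Type*} [NormedAddCommGroup E] [NormedSpace ℝ E]
    (X : Set E) (h ω : E → ℝ) (μ η : ℝ) (g : StrongDual ℝ E) (x₀ : E) (s₀ : StrongDual ℝ E)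
    (x₁ : E) (s₁ : StrongDual ℝ E) : Prop where
  mem : x₁ ∈ X
  isMin : IsMinOn (fun x => g x + h x + μ * ω x + η * proxFun ω x₀ s₀ x) X x₁
  subgrad : IsSubgradOn ω X x₁ s₁
  optimality : ∃ h₁ : StrongDual ℝ E, IsSubgradOn h X x₁ h₁ ∧
    ∀ x ∈ X, 0 ≤ (g + h₁ + (μ + η) • s₁ - η • s₀) (x - x₁)

/-- A procedure that evaluates the prox-mapping: from `g`, `x₀` and the selected subgradient of
`ω` at `x₀` it returns the new point with the selected subgradient of `ω` there. -/
def IsProxMap {E : Type*} [NormedAddCommGroup E] [NormedSpace ℝ E]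
    (X : Set E) (h ω : E → ℝ) (μ η : ℝ)
    (prox : StrongDual ℝ E → E → StrongDual ℝ E → E × StrongDual ℝ E) : Prop :=
  ∀ (g : StrongDual ℝ E) (x₀ : E) (s₀ : StrongDual ℝ E), IsSubgradOn ω X x₀ s₀ →
    IsProxStep X h ω μ η g x₀ s₀ (prox g x₀ s₀).1 (prox g x₀ s₀).2

/-- The variables of the method after iteration `t`: `xPrev = x^{t-1}`, `x = x^t`, the subgradient
`s` of `ω` selected at `x^t`, the points `u i` (the underlined `x_i^t`) and the gradients
`y i = y_i^t`. -/
structure State (m : ℕ) (E : Type*) [NormedAddCommGroup E] [NormedSpace ℝ E] where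
  xPrev : E
  x : E
  s : StrongDual ℝ E
  u : Fin m → E
  y : Fin m → StrongDual ℝ E

/-- The start: `x^{-1} = x^0`, `u_i = x^0`, `y_i = ∇ f_i (x^0)`. -/
def init {m : ℕ} {E : Type*} [NormedAddCommGroup E] [NormedSpace ℝ E]
    (f : Fin m → E → ℝ) (x₀ : E) (s₀ : StrongDual ℝ E) : State m E where
  xPrev := x₀
  x := x₀
  s := s₀
  u := fun _ => x₀
  y := fun i => fderiv ℝ (f i) x₀

/-- The extrapolated point `α (x^{t-1} - x^{t-2}) + x^{t-1}`. -/
def State.extrapolate {m : ℕ} {E : Type*} [NormedAddCommGroup E] [NormedSpace ℝ E]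
    (S : State m E) (α : ℝ) : E :=
  α • (S.x - S.xPrev) + S.x

/-- The new point `u_j = (1 + τ)⁻¹ (extrapolated point + τ u_j)`. -/
def State.newU {m : ℕ} {E : Type*} [NormedAddCommGroup E] [NormedSpace ℝ E]
    (S : State m E) (τ α : ℝ) (j : Fin m) : E :=
  (1 + τ)⁻¹ • (S.extrapolate α + τ • S.u j)

/-- One iteration, with sampled index `j`: only the gradient of `f j` is evaluated. -/
def step {m : ℕ} {E : Type*} [NormedAddCommGroup E] [NormedSpace ℝ E]
    (f : Fin m → E → ℝ) (p : Fin m → ℝ) (τ α : ℝ)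
    (prox : StrongDual ℝ E → E → StrongDual ℝ E → E × StrongDual ℝ E)
    (S : State m E) (j : Fin m) : State m E :=
  let yj : StrongDual ℝ E := fderiv ℝ (f j) (S.newU τ α j)
  let r := prox ((∑ i, S.y i) + (p j)⁻¹ • (yj - S.y j)) S.x S.s
  { xPrev := S.x
    x := r.1
    s := r.2
    u := Function.update S.u j (S.newU τ α j)
    y := Function.update S.y j yj }

/-- The state after `t` iterations, along the sampled indices `i_1 = ι 0, i_2 = ι 1, …`. -/
def run {m : ℕ} {E : Type*} [NormedAddCommGroup E] [NormedSpace ℝ E]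
    (f : Fin m → E → ℝ) (p : Fin m → ℝ) (τ α : ℝ)
    (prox : StrongDual ℝ E → E → StrongDual ℝ E → E × StrongDual ℝ E)
    (x₀ : E) (s₀ : StrongDual ℝ E) (ι : ℕ → Fin m) : ℕ → State m E
  | 0 => init f x₀ s₀
  | t + 1 => step f p τ α prox (run f p τ α prox x₀ s₀ ι t) (ι t)

/-- The output after `k` iterations: the mean of `x^1, …, x^k` with weights `θ_t = α^{-t}`. -/
def output {m : ℕ} {E : Type*} [NormedAddCommGroup E] [NormedSpace ℝ E]
    (f : Fin m → E → ℝ) (p : Fin m → ℝ) (τ α : ℝ)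
    (prox : StrongDual ℝ E → E → StrongDual ℝ E → E × StrongDual ℝ E)
    (x₀ : E) (s₀ : StrongDual ℝ E) (ι : ℕ → Fin m) (k : ℕ) : E :=
  (∑ t ∈ Finset.Icc 1 k, (α ^ t)⁻¹)⁻¹ •
    ∑ t ∈ Finset.Icc 1 k, (α ^ t)⁻¹ • (run f p τ α prox x₀ s₀ ι t).x

/-! ### The parameters of the method for non-uniform sampling, with `C = 8 L / μ` -/

/-- `p_i = 1 / (2 m) + L_i / (2 L)` with `L = ∑ L_i`. -/
def samplingProb {m : ℕ} (L : Fin m → ℝ) (i : Fin m) : ℝ :=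
  1 / (2 * m) + L i / (2 * ∑ j, L j)

/-- `√((m - 1)² + 4 m C)`. -/
def parRoot (m : ℕ) (C : ℝ) : ℝ := Real.sqrt (((m : ℝ) - 1) ^ 2 + 4 * m * C)

def parTau (m : ℕ) (C : ℝ) : ℝ := (parRoot m C - ((m : ℝ) - 1)) / (2 * m)

def parEta (m : ℕ) (μ C : ℝ) : ℝ := (μ * parRoot m C + μ * ((m : ℝ) - 1)) / 2

def parAlpha (m : ℕ) (C : ℝ) : ℝ := 1 - 1 / (((m : ℝ) + 1) + parRoot m C)

/-! ### Structured nonsmooth problems -/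

/-- The data of the problem `min {∑ f_i x + h x + μ ω x : x ∈ X}` with
`f_i x = max {⟨A_i x, y⟩ - q_i y : y ∈ Y_i}`, together with the functions `v_i` used for
smoothing and the bounds `Ω_{Y_i}`. The spaces carry arbitrary norms. -/
structure Problem (m : ℕ) (E : Type*) [NormedAddCommGroup E] [NormedSpace ℝ E]
    (F : Fin m → Type*) [∀ i, NormedAddCommGroup (F i)] [∀ i, NormedSpace ℝ (F i)] where
  X : Set E
  h : E → ℝ
  ω : E → ℝ
  μ : ℝ
  A : ∀ i, E →L[ℝ] StrongDual ℝ (F i)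
  Y : ∀ i, Set (F i)
  q : ∀ i, F i → ℝ
  v : ∀ i, F i → ℝ
  ΩY : Fin m → ℝ

namespace Problem

variable {m : ℕ} {E : Type*} [NormedAddCommGroup E] [NormedSpace ℝ E]
  {F : Fin m → Type*} [∀ i, NormedAddCommGroup (F i)] [∀ i, NormedSpace ℝ (F i)]

/-- The standing assumptions. The last one says that the maxima in the definitions of `f_i` and
of its smoothings are attained. -/
structure IsAdmissible (D : Problem m E F) : Prop where
  isClosed_X : IsClosed D.X
  convexOn_h : ConvexOn ℝ D.X D.h
  strongConvexOn_ω : StrongConvexOn D.X 1 D.ω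
  μ_pos : 0 < D.μ
  nonempty_Y : ∀ i, (D.Y i).Nonempty
  convexOn_q : ∀ i, ConvexOn ℝ (D.Y i) (D.q i)
  strongConvexOn_v : ∀ i, StrongConvexOn (D.Y i) 1 (D.v i)
  ΩY_nonneg : ∀ i, 0 ≤ D.ΩY i
  v_bounds : ∀ i, ∀ y ∈ D.Y i, 0 ≤ D.v i y ∧ D.v i y ≤ D.ΩY i ^ 2
  max_attained : ∀ i, ∀ δ : ℝ, 0 ≤ δ → ∀ x : E,
    ∃ y ∈ D.Y i, IsMaxOn (fun y => D.A i x y - D.q i y - δ * D.v i y) (D.Y i) y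

/-- `f_i x = max {⟨A_i x, y⟩ - q_i y : y ∈ Y_i}`. -/
def f (D : Problem m E F) (i : Fin m) (x : E) : ℝ :=
  sSup ((fun y => D.A i x y - D.q i y) '' D.Y i)

/-- The objective `Ψ = ∑ f_i + h + μ ω`. -/
def Psi (D : Problem m E F) (x : E) : ℝ :=
  (∑ i, D.f i x) + D.h x + D.μ * D.ω x

/-- The optimal value `Ψ*`. -/
def PsiStar (D : Problem m E F) : ℝ := sInf (D.Psi '' D.X)

/-- The smoothed component `max {⟨A_i x, y⟩ - q_i y - δ v_i y : y ∈ Y_i}`. -/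
def fSmooth (D : Problem m E F) (δ : ℝ) (i : Fin m) (x : E) : ℝ :=
  sSup ((fun y => D.A i x y - D.q i y - δ * D.v i y) '' D.Y i)

/-- The objective of the approximation problem. -/
def PsiSmooth (D : Problem m E F) (δ : ℝ) (x : E) : ℝ :=
  (∑ i, D.fSmooth δ i x) + D.h x + D.μ * D.ω x

/-- `‖A‖`, where `‖A‖² = ∑ ‖A_i‖²`. -/
def normA (D : Problem m E F) : ℝ := Real.sqrt (∑ i, ‖D.A i‖ ^ 2)

/-- `Ω_Y`, where `Ω_Y² = ∑ Ω_{Y_i}²`. -/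
def OmegaY (D : Problem m E F) : ℝ := Real.sqrt (∑ i, D.ΩY i ^ 2)

/-- The smoothing parameter `δ = ε / (2 Ω_Y²)`. -/
def delta (D : Problem m E F) (ε : ℝ) : ℝ := ε / (2 * D.OmegaY ^ 2)

/-- The Lipschitz constants `‖A_i‖² / δ` of the gradients of the smoothed components. -/
def lip (D : Problem m E F) (ε : ℝ) (i : Fin m) : ℝ := ‖D.A i‖ ^ 2 / D.delta ε

/-- `C = 8 L / μ` for the approximation problem. -/
def condC (D : Problem m E F) (ε : ℝ) : ℝ := 8 * (∑ i, D.lip ε i) / D.μ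

/-- The output after `k` iterations of the method, applied to the approximation problem with
smoothing parameter `δ = ε / (2 Ω_Y²)`, along the sampled indices `ι`. -/
def xbar (D : Problem m E F) (ε : ℝ)
    (prox : StrongDual ℝ E → E → StrongDual ℝ E → E × StrongDual ℝ E)
    (x₀ : E) (s₀ : StrongDual ℝ E) (ι : ℕ → Fin m) (k : ℕ) : E :=
  output (D.fSmooth (D.delta ε)) (samplingProb (D.lip ε)) (parTau m (D.condC ε))
    (parAlpha m (D.condC ε)) prox x₀ s₀ ι k

end Problem

end RPDG

end

noncomputable section

namespace RPDG

/-! ### Convexity -/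

/-! The argument is smoothing plus linear convergence of the randomized method on the smoothed
problem. By strong convexity of `v i`, each smoothed component is differentiable, with the two-sided
estimates of an `‖A_i‖² / δ`-smooth convex function (`isSmoothConvex_fSmooth`). Smoothing moves the
optimality gap by at most `δ Ω_Y² = ε / 2` (`Psi_sub_PsiStar_le`), so it remains to solve the
smoothed problem to accuracy `ε / 2`.

Let `z` be the smoothed minimizer. The method is a primal-dual proximal scheme; the dual distance to
the gradient at `z` is expressed through the primal point as `bregman (f i) (u i) z`, so conjugates
never appear. Adding the three-point inequalities of the primal and dual steps and averaging over
the sampled index, the expected `potential` plus the current gap is at most `α` times the old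
potential (`sum_potential_step_le`). Since the potential is nonnegative, telescoping with weights
`α⁻ᵗ` bounds the weighted expected gaps by the initial potential (`sum_integral_le`).

That gap is `linGap`, which linearizes the smooth part at `z`, plus half of the strong convexity
term. The missing Bregman part of the objective is at most `Λ / 2 * ‖x - z‖²`, paid for by that half
at the price of a factor `2 Λ / μ`; Jensen's inequality then passes to the averaged output
(`objective_output_le`). This factor and the initial potential are polynomial in `R = m B w`, and
hence only enter the logarithm, while `α = 1 - 1 / N` with `N ≤ 11 √m B` fixes the leading factor.
Part (b) is Markov's inequality for the nonnegative smoothed gap. -/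

theorem nonneg_of_forall_add_mul_nonneg {b K : ℝ}
    (hb : ∀ a : ℝ, 0 < a → a < 1 → 0 ≤ b + a * K) : 0 ≤ b := by
  have ht : Filter.Tendsto (fun a : ℝ => b + a * K) (nhdsWithin 0 (Set.Ioi 0)) (nhds (b + 0 * K)) :=
    Filter.Tendsto.mono_left (Continuous.tendsto (by fun_prop) 0) nhdsWithin_le_nhds
  have := ge_of_tendsto ht (b := 0) (by
    filter_upwards [Ioo_mem_nhdsGT (zero_lt_one (α := ℝ))] with a ha using hb a ha.1 ha.2)
  simpa using this

section Convexity

variable {E : Type*} [NormedAddCommGroup E] [NormedSpace ℝ E]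

/-- Quadratic growth of a strongly convex function away from its minimizer. -/
theorem quadratic_growth {X : Set E} {δ : ℝ} {ψ : E → ℝ}
    (hψ : StrongConvexOn X δ ψ) {x₀ : E} (hx₀ : x₀ ∈ X) (hmin : IsMinOn ψ X x₀) {x : E}
    (hx : x ∈ X) : ψ x₀ + δ / 2 * ‖x - x₀‖ ^ 2 ≤ ψ x := by
  have key : 0 ≤ ψ x - ψ x₀ - δ / 2 * ‖x - x₀‖ ^ 2 := by
    -- Compare `x₀` with the point a fraction `a` of the way to `x`, divide by `a`, and let `a` tend
    -- to `0`.
    refine nonneg_of_forall_add_mul_nonneg (K := δ / 2 * ‖x - x₀‖ ^ 2) fun a ha ha1 => ?_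
    have h1 := hψ.2 hx hx₀ ha.le (sub_nonneg.2 ha1.le) (by ring)
    have h2 : ψ x₀ ≤ ψ (a • x + (1 - a) • x₀) :=
      hmin (hψ.1 hx hx₀ ha.le (sub_nonneg.2 ha1.le) (by ring))
    simp only [smul_eq_mul] at h1
    refine nonneg_of_mul_nonneg_right (a := a) ?_ ha
    linarith
  linarith

/-- Subtracting the linear functional `s₀` preserves strong convexity and makes `x₀` a minimizer, so
quadratic growth applies. -/
theorem half_sq_norm_le_proxFun {X : Set E} {ω : E → ℝ} (hω : StrongConvexOn X 1 ω)
    {x₀ : E} {s₀ : StrongDual ℝ E} (hs : IsSubgradOn ω X x₀ s₀) {x : E} (hx : x ∈ X) :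
    1 / 2 * ‖x - x₀‖ ^ 2 ≤ proxFun ω x₀ s₀ x := by
  have hsc : StrongConvexOn X 1 (fun z => ω z - s₀ z) := by
    refine ⟨hω.1, fun y hy z hz a b ha hb hab => ?_⟩
    have := hω.2 hy hz ha hb hab
    simp only [smul_eq_mul, map_add, map_smul] at this ⊢
    linarith
  have := quadratic_growth hsc hs.1 (fun z hz => by
    have := hs.2 z hz
    simp only [map_sub, Set.mem_ofPred_eq] at this ⊢
    linarith) hx
  simp only [proxFun, map_sub] at this ⊢
  linarith

/-- The Bregman divergence of `f`; it is the Bregman divergence between the gradients of `f` at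
`z` and `u` with respect to the conjugate of `f`. -/
def bregman (f : E → ℝ) (u z : E) : ℝ := f u - f z - fderiv ℝ f z (u - z)

/-- Convex functions whose gradient is Lipschitz with constant `L`. -/
structure IsSmoothConvex (f : E → ℝ) (L : ℝ) : Prop where
  nonneg : ∀ u z, 0 ≤ bregman f u z
  upper : ∀ u z, bregman f u z ≤ L / 2 * ‖u - z‖ ^ 2
  lower : ∀ u z, ‖fderiv ℝ f u - fderiv ℝ f z‖ ^ 2 ≤ 2 * L * bregman f u z

/-- First-order optimality for the sum of a smooth and a convex function. -/
theorem first_order_optimality {X : Set E} {f φ : E → ℝ} {f' : StrongDual ℝ E} {L : ℝ}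
    {x₀ : E} (hx₀ : x₀ ∈ X) (hf : ∀ x, f x ≤ f x₀ + f' (x - x₀) + L / 2 * ‖x - x₀‖ ^ 2)
    (hφ : ConvexOn ℝ X φ) (hmin : IsMinOn (fun x => f x + φ x) X x₀) {x : E} (hx : x ∈ X) :
    0 ≤ f' (x - x₀) + φ x - φ x₀ := by
  refine nonneg_of_forall_add_mul_nonneg (K := L / 2 * ‖x - x₀‖ ^ 2) fun a ha ha1 => ?_
  have h1 := hφ.2 hx hx₀ ha.le (sub_nonneg.2 ha1.le) (by ring)
  have h2 : f x₀ + φ x₀ ≤ f (a • x + (1 - a) • x₀) + φ (a • x + (1 - a) • x₀) :=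
    hmin (hφ.1 hx hx₀ ha.le (sub_nonneg.2 ha1.le) (by ring))
  have h3 := hf (a • x + (1 - a) • x₀)
  have h4 : a • x + (1 - a) • x₀ - x₀ = a • (x - x₀) := by module
  rw [h4, map_smul, norm_smul, Real.norm_of_nonneg ha.le] at h3
  simp only [smul_eq_mul] at h1 h3
  refine nonneg_of_mul_nonneg_right (a := a) ?_ ha
  linarith

end Convexity

/-! ### Smoothing -/

namespace Problem

variable {m : ℕ} {E : Type*} [NormedAddCommGroup E] [NormedSpace ℝ E]
  {F : Fin m → Type*} [∀ i, NormedAddCommGroup (F i)] [∀ i, NormedSpace ℝ (F i)]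
  {D : Problem m E F}

theorem IsAdmissible.exists_maximizer (hD : D.IsAdmissible) {δ : ℝ} (hδ : 0 ≤ δ) (i : Fin m)
    (x : E) : ∃ y ∈ D.Y i, D.fSmooth δ i x = D.A i x y - D.q i y - δ * D.v i y ∧
      ∀ z ∈ D.Y i, D.A i x z - D.q i z - δ * D.v i z + δ / 2 * ‖z - y‖ ^ 2 ≤ D.fSmooth δ i x := by
  obtain ⟨y, hy, hmax⟩ := hD.max_attained i δ hδ x
  have hval : D.fSmooth δ i x = D.A i x y - D.q i y - δ * D.v i y :=
    IsGreatest.csSup_eq ⟨⟨y, hy, rfl⟩, by rintro _ ⟨z, hz, rfl⟩; exact hmax hz⟩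
  refine ⟨y, hy, hval, fun z hz => ?_⟩
  have hsc : StrongConvexOn (D.Y i) δ (fun z => D.q i z + δ * D.v i z - D.A i x z) := by
    refine ⟨(hD.convexOn_q i).1, fun y hy z hz a b ha hb hab => ?_⟩
    have h1 := (hD.convexOn_q i).2 hy hz ha hb hab
    have h2 := mul_le_mul_of_nonneg_left ((hD.strongConvexOn_v i).2 hy hz ha hb hab) hδ
    simp only [smul_eq_mul, map_add, map_smul] at h1 h2 ⊢
    linarith
  have := quadratic_growth hsc hy (fun z hz => by
    have := hmax hz
    simp only [Set.mem_ofPred_eq] at this ⊢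
    linarith) hz
  rw [hval]
  linarith

/-- All three estimates come from comparing the maximizers `y u` and `y z` as competitors for each
other, with the quadratic growth of the inner problem. The gradient at `z` is `A_i` transposed
applied to `y z`; no Euclidean structure is needed. -/
theorem IsAdmissible.isSmoothConvex_fSmooth (hD : D.IsAdmissible) {δ : ℝ} (hδ : 0 < δ)
    (i : Fin m) : IsSmoothConvex (D.fSmooth δ i) (‖D.A i‖ ^ 2 / δ) := by
  choose y hyY hval hgrow using hD.exists_maximizer hδ.le i
  have hlow : ∀ u z, δ / 2 * ‖y u - y z‖ ^ 2 ≤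
      D.fSmooth δ i u - D.fSmooth δ i z - D.A i (u - z) (y z) := fun u z => by
    have := hgrow u (y z) (hyY z)
    rw [hval z, map_sub, sub_apply, norm_sub_rev (y u)]
    linarith
  have hup : ∀ u z, D.fSmooth δ i u - D.fSmooth δ i z - D.A i (u - z) (y z) ≤
      ‖D.A i‖ ^ 2 / δ / 2 * ‖u - z‖ ^ 2 := fun u z => by
    have h1 := hgrow z (y u) (hyY u)
    have h2 : D.A i (u - z) (y u - y z) ≤ ‖D.A i‖ * ‖u - z‖ * ‖y u - y z‖ :=
      (le_abs_self _).trans ((D.A i).le_opNorm₂ _ _)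
    have h3 : ‖D.A i‖ * ‖u - z‖ * ‖y u - y z‖ ≤
        ‖D.A i‖ ^ 2 / δ / 2 * ‖u - z‖ ^ 2 + δ / 2 * ‖y u - y z‖ ^ 2 := by
      have := sq_nonneg (‖D.A i‖ * ‖u - z‖ - δ * ‖y u - y z‖)
      have h4 : ‖D.A i‖ ^ 2 / δ / 2 * ‖u - z‖ ^ 2 + δ / 2 * ‖y u - y z‖ ^ 2 -
        ‖D.A i‖ * ‖u - z‖ * ‖y u - y z‖ =
        (‖D.A i‖ * ‖u - z‖ - δ * ‖y u - y z‖) ^ 2 / (2 * δ) := by field_simp; ring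
      have h5 : 0 ≤ (‖D.A i‖ * ‖u - z‖ - δ * ‖y u - y z‖) ^ 2 / (2 * δ) := by positivity
      linarith
    rw [hval u]
    simp only [map_sub, sub_apply] at h2 ⊢
    linarith
  -- The linearization error lies between `0` and a multiple of `‖u - z‖²`, which already forces
  -- differentiability.
  have hderiv : ∀ z, HasFDerivAt (D.fSmooth δ i) ((D.A i).flip (y z)) z := fun z => by
    refine .of_isLittleO (Asymptotics.IsBigO.trans_isLittleO (g := fun u => ‖u - z‖ ^ 2) ?_ ?_)
    · refine Asymptotics.IsBigO.of_bound (‖D.A i‖ ^ 2 / δ / 2) (Filter.Eventually.of_forall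
        fun u => ?_)
      have h1 := hlow u z
      have h2 := hup u z
      have h3 : 0 ≤ δ / 2 * ‖y u - y z‖ ^ 2 := by positivity
      rw [ContinuousLinearMap.flip_apply, Real.norm_of_nonneg (h3.trans h1), norm_pow, norm_norm]
      exact h2
    · have := (Asymptotics.isLittleO_norm_pow_id (E' := E) one_lt_two).comp_tendsto
        (k := fun u => u - z) (l' := nhds z) (by
          have : Filter.Tendsto (fun u => u - z) (nhds z) (nhds (z - z)) :=
            Continuous.tendsto (by fun_prop) z
          simpa using this)
      exact this
  have hfd : ∀ z, fderiv ℝ (D.fSmooth δ i) z = (D.A i).flip (y z) := fun z => (hderiv z).fderiv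
  refine ⟨fun u z => ?_, fun u z => ?_, fun u z => ?_⟩
  · have h3 : 0 ≤ δ / 2 * ‖y u - y z‖ ^ 2 := by positivity
    rw [bregman, hfd]
    exact h3.trans (hlow u z)
  · rw [bregman, hfd]
    exact hup u z
  · rw [bregman, hfd, hfd, ← map_sub]
    have h1 : ‖(D.A i).flip (y u - y z)‖ ≤ ‖D.A i‖ * ‖y u - y z‖ := by
      simpa using (D.A i).flip.le_opNorm (y u - y z)
    have h2 := mul_le_mul_of_nonneg_left (hlow u z) (a := 2 * (‖D.A i‖ ^ 2 / δ)) (by positivity)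
    calc _ ≤ (‖D.A i‖ * ‖y u - y z‖) ^ 2 := by gcongr
      _ = 2 * (‖D.A i‖ ^ 2 / δ) * (δ / 2 * ‖y u - y z‖ ^ 2) := by field_simp
      _ ≤ _ := h2

theorem f_eq_fSmooth_zero (D : Problem m E F) (i : Fin m) (x : E) :
    D.f i x = D.fSmooth 0 i x := by
  simp [f, fSmooth]

theorem IsAdmissible.fSmooth_le_f (hD : D.IsAdmissible) {δ : ℝ} (hδ : 0 ≤ δ) (i : Fin m)
    (x : E) : D.fSmooth δ i x ≤ D.f i x := by
  obtain ⟨y, hy, hval, -⟩ := hD.exists_maximizer hδ i x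
  obtain ⟨_, -, -, hz⟩ := hD.exists_maximizer le_rfl i x
  have := hz y hy
  have := mul_nonneg hδ (hD.v_bounds i y hy).1
  rw [f_eq_fSmooth_zero, hval]
  linarith

theorem IsAdmissible.f_le_fSmooth_add (hD : D.IsAdmissible) {δ : ℝ} (hδ : 0 ≤ δ) (i : Fin m)
    (x : E) : D.f i x ≤ D.fSmooth δ i x + δ * D.ΩY i ^ 2 := by
  obtain ⟨z, -, -, hy⟩ := hD.exists_maximizer hδ i x
  obtain ⟨y, hyY, hval, -⟩ := hD.exists_maximizer le_rfl i x
  have := hy y hyY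
  have := mul_le_mul_of_nonneg_left (hD.v_bounds i y hyY).2 hδ
  have : 0 ≤ δ / 2 * ‖y - z‖ ^ 2 := by positivity
  rw [f_eq_fSmooth_zero, hval]
  linarith

theorem OmegaY_sq (D : Problem m E F) : D.OmegaY ^ 2 = ∑ i, D.ΩY i ^ 2 :=
  Real.sq_sqrt (Finset.sum_nonneg fun _ _ => sq_nonneg _)

theorem normA_sq (D : Problem m E F) : D.normA ^ 2 = ∑ i, ‖D.A i‖ ^ 2 :=
  Real.sq_sqrt (Finset.sum_nonneg fun _ _ => sq_nonneg _)

/-- The gap of the smoothed problem controls the gap of the original one. -/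
theorem IsAdmissible.Psi_sub_PsiStar_le (hD : D.IsAdmissible) {δ : ℝ} (hδ : 0 ≤ δ) {z : E}
    (hz : z ∈ D.X) (hmin : IsMinOn (D.PsiSmooth δ) D.X z) (x : E) :
    D.Psi x - D.PsiStar ≤ D.PsiSmooth δ x - D.PsiSmooth δ z + δ * D.OmegaY ^ 2 := by
  have h1 : D.PsiSmooth δ z ≤ D.PsiStar := by
    refine le_csInf ⟨_, z, hz, rfl⟩ ?_
    rintro _ ⟨w, hw, rfl⟩
    refine (hmin hw).trans ?_
    simp only [PsiSmooth, Psi]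
    gcongr with i
    exact hD.fSmooth_le_f hδ i w
  have h2 : D.Psi x ≤ D.PsiSmooth δ x + δ * D.OmegaY ^ 2 := by
    have := Finset.sum_le_sum fun i (_ : i ∈ Finset.univ) => hD.f_le_fSmooth_add hδ i x
    rw [Finset.sum_add_distrib, ← Finset.mul_sum, ← OmegaY_sq] at this
    simp only [PsiSmooth, Psi]
    linarith
  linarith

end Problem

/-! ### One iteration of the method -/

section Iteration

variable {m : ℕ} {E : Type*} [NormedAddCommGroup E] [NormedSpace ℝ E]

theorem sum_apply_update {ι β M : Type*} [Fintype ι] [DecidableEq ι] [AddCommGroup M]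
    (g : ι → β → M) (u : ι → β) (j : ι) (b : β) :
    ∑ i, g i (Function.update u j b i) = ∑ i, g i (u i) + (g j b - g j (u j)) := by
  rw [← sub_eq_iff_eq_add', ← Finset.sum_sub_distrib, Finset.sum_eq_single j]
  · simp
  · intro i _ hij
    simp [Function.update_of_ne hij]
  · simp

/-- The relations between the parameters of the method that drive the convergence, where `Λ` is
the sum of the Lipschitz constants `L i`. -/
structure ParamBounds (L p : Fin m → ℝ) (μ τ η α Λ : ℝ) : Prop where
  Λ_pos : 0 < Λ
  μ_pos : 0 < μ
  τ_pos : 0 < τ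
  η_nonneg : 0 ≤ η
  α_pos : 0 < α
  α_le_one : α ≤ 1
  p_pos : ∀ i, 0 < p i
  sum_p : ∑ i, p i = 1
  L_le : ∀ i, L i ≤ 2 * Λ * p i
  η_mul_τ : η * τ = 8 * Λ
  η_le : η ≤ α * (μ / 2 + η)
  one_sub_α_mul_le : ∀ i, (1 - α) * (1 + τ) ≤ p i

/-- The states that the method can reach. -/
structure State.IsValid (S : State m E) (f : Fin m → E → ℝ) (ω : E → ℝ) (X : Set E) : Prop where
  subgrad : IsSubgradOn ω X S.x S.s
  y_eq : ∀ i, S.y i = fderiv ℝ (f i) (S.u i)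

/-- The excess over the value at `z` of the objective `∑ f i + h + μ ω` with the smooth part
linearized at `z`. -/
def linGap (f : Fin m → E → ℝ) (h ω : E → ℝ) (μ : ℝ) (z x : E) : ℝ :=
  (∑ i, fderiv ℝ (f i) z) (x - z) + (h x + μ * ω x) - (h z + μ * ω z)

/-- The Lyapunov function of the method with respect to the solution `z`. -/
def potential (f : Fin m → E → ℝ) (p : Fin m → ℝ) (ω : E → ℝ) (μ τ η Λ : ℝ) (z : E)
    (S : State m E) : ℝ :=
  (μ / 2 + η) * proxFun ω S.x S.s z + ∑ i, (1 + τ) / p i * bregman (f i) (S.u i) z -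
    (∑ i, (fderiv ℝ (f i) z - S.y i)) (S.x - S.xPrev) + 2 * Λ / τ * ‖S.x - S.xPrev‖ ^ 2

/-- Young's inequality, weighted so that two uses consume exactly the term `τ * B` left over by the
dual step. -/
theorem mul_le_of_sq_le {Λ τ p a c B : ℝ} (hΛ : 0 < Λ) (hτ : 0 < τ) (hp : 0 < p)
    (hc : c ^ 2 ≤ 4 * Λ * p * B) : a * c ≤ p * (2 * Λ / τ) * a ^ 2 + τ / 2 * B := by
  have h1 : 0 ≤ (4 * Λ * p * a - τ * c) ^ 2 / (8 * Λ * p * τ) := by positivity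
  have h2 : (4 * Λ * p * a - τ * c) ^ 2 / (8 * Λ * p * τ) =
      p * (2 * Λ / τ) * a ^ 2 - a * c + τ / (8 * Λ * p) * c ^ 2 := by field_simp; ring
  have h3 : τ / (8 * Λ * p) * c ^ 2 ≤ τ / (8 * Λ * p) * (4 * Λ * p * B) := by gcongr
  have h4 : τ / (8 * Λ * p) * (4 * Λ * p * B) = τ / 2 * B := by field_simp; ring
  linarith

variable {f : Fin m → E → ℝ} {L p : Fin m → ℝ} {X : Set E} {h ω : E → ℝ} {μ τ η α Λ : ℝ}

theorem ParamBounds.sq_norm_le (hP : ParamBounds L p μ τ η α Λ)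
    (hf : ∀ i, IsSmoothConvex (f i) (L i)) (i : Fin m) (u z : E) :
    ‖fderiv ℝ (f i) u - fderiv ℝ (f i) z‖ ^ 2 ≤ 4 * Λ * p i * bregman (f i) u z := by
  refine ((hf i).lower u z).trans ?_
  have := mul_le_mul_of_nonneg_right (hP.L_le i) ((hf i).nonneg u z)
  linarith

/-- The three-point inequality of the prox-step. -/
theorem IsProxStep.three_point {g : StrongDual ℝ E} {x₀ x₁ : E} {s₀ s₁ : StrongDual ℝ E}
    (hs : IsProxStep X h ω μ η g x₀ s₀ x₁ s₁) {z : E} (hz : z ∈ X) :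
    (h x₁ + μ * ω x₁) - (h z + μ * ω z) ≤
      η * proxFun ω x₀ s₀ z - (μ + η) * proxFun ω x₁ s₁ z - η * proxFun ω x₀ s₀ x₁ -
        g (x₁ - z) := by
  obtain ⟨h₁, hh, hopt⟩ := hs.optimality
  have h1 := hopt z hz
  have h2 := hh.2 z hz
  simp only [proxFun, map_sub, add_apply, sub_apply, smul_apply, smul_eq_mul] at h1 h2 ⊢
  linarith

/-- The three-point inequality of the dual step, in terms of the primal points. -/
theorem dual_three_point {φ : E → ℝ} {l : ℝ} (hφ : IsSmoothConvex φ l) {u û w z : E}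
    (hû : (1 + τ) • û = w + τ • u) :
    (1 + τ) * bregman φ û z + τ * bregman φ u û ≤
      τ * bregman φ u z + (fderiv ℝ φ z - fderiv ℝ φ û) (z - w) := by
  -- The claim is an identity up to the discarded nonnegative term `bregman φ z û`.
  have h0 := hφ.nonneg z û
  obtain rfl : w = (1 + τ) • û - τ • u := by rw [hû]; abel
  simp only [bregman, map_sub, map_smul, sub_apply, smul_eq_mul] at h0 ⊢
  linarith

variable {prox : StrongDual ℝ E → E → StrongDual ℝ E → E × StrongDual ℝ E}

theorem State.IsValid.step {S : State m E} (hS : S.IsValid f ω X)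
    (hprox : IsProxMap X h ω μ η prox) (j : Fin m) :
    (RPDG.step f p τ α prox S j).IsValid f ω X := by
  refine ⟨(hprox _ _ _ hS.subgrad).subgrad, fun i => ?_⟩
  by_cases hij : i = j
  · subst hij
    simp [RPDG.step]
  · simp [RPDG.step, Function.update_of_ne hij, hS.y_eq]

/-- The bound for a fixed index, multiplied by `p j` to remove the importance weight in `g`. The
right side refers to the old state only, and its terms in `S.x - z` cancel after summation over `j`.
-/
theorem potential_step_le (hP : ParamBounds L p μ τ η α Λ)
    (hf : ∀ i, IsSmoothConvex (f i) (L i)) (hω : StrongConvexOn X 1 ω)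
    (hprox : IsProxMap X h ω μ η prox) {S : State m E} (hS : S.IsValid f ω X) {z : E}
    (hz : z ∈ X) (j : Fin m) :
    p j * (linGap f h ω μ z (step f p τ α prox S j).x +
        μ / 2 * proxFun ω (step f p τ α prox S j).x (step f p τ α prox S j).s z +
        potential f p ω μ τ η Λ z (step f p τ α prox S j)) ≤
      p j * (η * proxFun ω S.x S.s z + ∑ i, (1 + τ) / p i * bregman (f i) (S.u i) z +
          (∑ i, (fderiv ℝ (f i) z - S.y i)) (S.x - z)) -
        bregman (f j) (S.u j) z - (fderiv ℝ (f j) z - S.y j) (S.x - z) -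
        α * (fderiv ℝ (f j) z - S.y j) (S.x - S.xPrev) +
        p j * α ^ 2 * (2 * Λ / τ * ‖S.x - S.xPrev‖ ^ 2) := by
  set û := S.newU τ α j with hûdef
  set ŷ := fderiv ℝ (f j) û with hŷ
  set g : StrongDual ℝ E := (∑ i, S.y i) + (p j)⁻¹ • (ŷ - S.y j) with hg
  have hstep := hprox g S.x S.s hS.subgrad
  set r := prox g S.x S.s with hr
  have hpj := hP.p_pos j
  have hτ := hP.τ_pos
  have hx : (step f p τ α prox S j).x = r.1 := rfl
  have hs : (step f p τ α prox S j).s = r.2 := rfl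
  have hxp : (step f p τ α prox S j).xPrev = S.x := rfl
  have hu : (step f p τ α prox S j).u = Function.update S.u j û := rfl
  have hy : (step f p τ α prox S j).y = Function.update S.y j ŷ := rfl
  have hprimal := hstep.three_point hz
  have hquad := half_sq_norm_le_proxFun hω hS.subgrad hstep.mem
  have hdual := dual_three_point (hf j) (u := S.u j) (û := û) (w := S.extrapolate α) (z := z)
    (τ := τ) (by
      rw [hûdef, State.newU, smul_smul, mul_inv_cancel₀ (by positivity), one_smul])
  have hd2 := hP.sq_norm_le hf j (S.u j) û
  rw [← hS.y_eq j, ← hŷ, norm_sub_rev] at hd2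
  rw [← hŷ] at hdual
  have hyoung1 := mul_le_of_sq_le (a := ‖r.1 - S.x‖) hP.Λ_pos hτ hpj hd2
  have hyoung2 := mul_le_of_sq_le (a := α * ‖S.x - S.xPrev‖) hP.Λ_pos hτ hpj hd2
  -- The gradient correction enters `p j * g` with coefficient `1`; the change of the cross term of
  -- the potential takes back `p j` of it.
  have hn1 : -((1 - p j) * (ŷ - S.y j) (r.1 - S.x)) ≤ ‖r.1 - S.x‖ * ‖ŷ - S.y j‖ := by
    have h1 : |(ŷ - S.y j) (r.1 - S.x)| ≤ ‖r.1 - S.x‖ * ‖ŷ - S.y j‖ := by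
      rw [mul_comm]; exact (ŷ - S.y j).le_opNorm _
    have h2 : p j ≤ 1 := by
      rw [← hP.sum_p]
      exact Finset.single_le_sum (fun i _ => (hP.p_pos i).le) (Finset.mem_univ j)
    have h3 := mul_le_mul_of_nonneg_left (neg_le_abs ((ŷ - S.y j) (r.1 - S.x)))
      (sub_nonneg.2 h2)
    have h4 : (1 - p j) * |(ŷ - S.y j) (r.1 - S.x)| ≤ 1 * |(ŷ - S.y j) (r.1 - S.x)| :=
      mul_le_mul_of_nonneg_right (by linarith) (abs_nonneg _)
    linarith
  have hn2 : α * (ŷ - S.y j) (S.x - S.xPrev) ≤ α * ‖S.x - S.xPrev‖ * ‖ŷ - S.y j‖ := by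
    rw [mul_assoc]
    refine mul_le_mul_of_nonneg_left ?_ hP.α_pos.le
    rw [mul_comm]
    exact (le_abs_self _).trans ((ŷ - S.y j).le_opNorm _)
  -- With `κ = 2 * Λ / τ`, the prox term supplies `η / 2 = 2 * κ` times `‖r.1 - S.x‖ ^ 2`: one `κ`
  -- for Young's inequality and one for the new potential.
  have hη : η = 4 * (2 * Λ / τ) := by
    have := hP.η_mul_τ
    field_simp
    linarith
  have hquad' := mul_le_mul_of_nonneg_left hquad (mul_nonneg hpj.le hP.η_nonneg)
  have hprimal' := mul_le_mul_of_nonneg_left hprimal hpj.le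
  have hsumu := sum_apply_update (fun i v => (1 + τ) / p i * bregman (f i) v z) S.u j û
  have hsumy := sum_apply_update (fun i v => fderiv ℝ (f i) z - v) S.y j ŷ
  have hW : (∑ i, fderiv ℝ (f i) z) = ∑ i, (fderiv ℝ (f i) z - S.y i) + ∑ i, S.y i := by
    rw [Finset.sum_sub_distrib]; abel
  rw [potential, linGap, hx, hs, hxp, hu, hy, hsumu, hsumy, hW]
  have hpg : p j * g (r.1 - z) = p j * (∑ i, S.y i) (r.1 - z) + (ŷ - S.y j) (r.1 - z) := by
    rw [hg, add_apply, smul_apply, smul_eq_mul]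
    field_simp
  have hpB : p j * ((1 + τ) / p j * bregman (f j) û z - (1 + τ) / p j * bregman (f j) (S.u j) z)
      = (1 + τ) * bregman (f j) û z - (1 + τ) * bregman (f j) (S.u j) z := by
    field_simp
  generalize (∑ i, S.y i) = Y at *
  generalize ∑ i, (fderiv ℝ (f i) z - S.y i) = W at *
  generalize ∑ i, (1 + τ) / p i * bregman (f i) (S.u i) z = SB at *
  simp only [State.extrapolate, map_sub, map_add, map_smul, add_apply, sub_apply,
    smul_eq_mul] at *
  rw [hη] at *
  generalize 2 * Λ / τ = κ at *
  linarith

/-- Each piece of the potential contracts separately: the prox term by `η_le`, the Bregman terms by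
`one_sub_α_mul_le`, the cross term exactly by `α` through the extrapolation, the square by `α ^ 2 ≤
α`. -/
theorem sum_potential_step_le (hP : ParamBounds L p μ τ η α Λ)
    (hf : ∀ i, IsSmoothConvex (f i) (L i)) (hω : StrongConvexOn X 1 ω)
    (hprox : IsProxMap X h ω μ η prox) {S : State m E} (hS : S.IsValid f ω X) {z : E}
    (hz : z ∈ X) :
    ∑ j, p j * (linGap f h ω μ z (step f p τ α prox S j).x +
        μ / 2 * proxFun ω (step f p τ α prox S j).x (step f p τ α prox S j).s z +
        potential f p ω μ τ η Λ z (step f p τ α prox S j)) ≤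
      α * potential f p ω μ τ η Λ z S := by
  refine (Finset.sum_le_sum fun j _ => potential_step_le hP hf hω hprox hS hz j).trans ?_
  simp only [Finset.sum_add_distrib, Finset.sum_sub_distrib, ← Finset.sum_mul, hP.sum_p, one_mul,
    ← Finset.mul_sum]
  have hW : ∀ v, ∑ j, (fderiv ℝ (f j) z - S.y j) v = (∑ j, (fderiv ℝ (f j) z - S.y j)) v :=
    fun v => by simp
  have hprox0 : 0 ≤ proxFun ω S.x S.s z :=
    (by positivity : 0 ≤ 1 / 2 * ‖z - S.x‖ ^ 2).trans (half_sq_norm_le_proxFun hω hS.subgrad hz)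
  have h1 := mul_le_mul_of_nonneg_right hP.η_le hprox0
  have h2 : (1 - α) * ∑ i, (1 + τ) / p i * bregman (f i) (S.u i) z ≤
      ∑ i, bregman (f i) (S.u i) z := by
    rw [Finset.mul_sum]
    refine Finset.sum_le_sum fun i _ => ?_
    have h3 : (1 - α) * (1 + τ) / p i ≤ 1 :=
      (div_le_one (hP.p_pos i)).2 (hP.one_sub_α_mul_le i)
    have h4 := mul_le_mul_of_nonneg_right h3 ((hf i).nonneg (S.u i) z)
    calc _ = (1 - α) * (1 + τ) / p i * bregman (f i) (S.u i) z := by ring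
      _ ≤ _ := by linarith
  have h5 : 0 ≤ 2 * Λ / τ * ‖S.x - S.xPrev‖ ^ 2 := by
    have := hP.Λ_pos
    have := hP.τ_pos
    positivity
  have h6 : α ^ 2 ≤ α := by nlinarith [hP.α_pos, hP.α_le_one]
  have h7 := mul_le_mul_of_nonneg_right h6 h5
  rw [potential]
  simp only [hW, Finset.sum_sub_distrib] at *
  linarith

/-- The signed cross term is dominated, index by index, by the square weighted with `p i` and the
Bregman terms. -/
theorem potential_nonneg (hP : ParamBounds L p μ τ η α Λ)
    (hf : ∀ i, IsSmoothConvex (f i) (L i)) (hω : StrongConvexOn X 1 ω)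
    {S : State m E} (hS : S.IsValid f ω X) {z : E} (hz : z ∈ X) :
    0 ≤ potential f p ω μ τ η Λ z S := by
  have hτ := hP.τ_pos
  have hprox0 : 0 ≤ proxFun ω S.x S.s z :=
    (by positivity : 0 ≤ 1 / 2 * ‖z - S.x‖ ^ 2).trans (half_sq_norm_le_proxFun hω hS.subgrad hz)
  have h1 : (∑ i, (fderiv ℝ (f i) z - S.y i)) (S.x - S.xPrev) ≤
      ∑ i, (p i * (2 * Λ / τ * ‖S.x - S.xPrev‖ ^ 2) +
        (1 + τ) / p i * bregman (f i) (S.u i) z) := by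
    rw [sum_apply]
    refine Finset.sum_le_sum fun i _ => ?_
    have hd2 := hP.sq_norm_le hf i (S.u i) z
    rw [← hS.y_eq i, norm_sub_rev] at hd2
    have hy := mul_le_of_sq_le (a := ‖S.x - S.xPrev‖) hP.Λ_pos hτ (hP.p_pos i) hd2
    have h2 : (fderiv ℝ (f i) z - S.y i) (S.x - S.xPrev) ≤
        ‖S.x - S.xPrev‖ * ‖fderiv ℝ (f i) z - S.y i‖ := by
      rw [mul_comm]
      exact (le_abs_self _).trans ((fderiv ℝ (f i) z - S.y i).le_opNorm _)
    have hp1 : p i ≤ 1 := by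
      rw [← hP.sum_p]
      exact Finset.single_le_sum (fun i _ => (hP.p_pos i).le) (Finset.mem_univ i)
    have h3 : τ / 2 ≤ (1 + τ) / p i := by
      rw [le_div_iff₀ (hP.p_pos i)]
      nlinarith
    have h4 := mul_le_mul_of_nonneg_right h3 ((hf i).nonneg (S.u i) z)
    linarith
  rw [Finset.sum_add_distrib, ← Finset.sum_mul, hP.sum_p] at h1
  have h2 : 0 ≤ (μ / 2 + η) * proxFun ω S.x S.s z :=
    mul_nonneg (by linarith [hP.μ_pos, hP.η_nonneg]) hprox0
  rw [potential]
  linarith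

theorem init_isValid {x₀ : E} {s₀ : StrongDual ℝ E} (hs : IsSubgradOn ω X x₀ s₀) :
    (init f x₀ s₀).IsValid f ω X :=
  ⟨hs, fun _ => rfl⟩

end Iteration

/-! ### Expectations over independent indices -/

section Sampling

variable {m : ℕ} {Ω : Type*} [MeasurableSpace Ω] {P : Measure Ω} [IsProbabilityMeasure P]
  {ι : ℕ → Ω → Fin m}

theorem exists_eq_comp_prefix [NeZero m] {β : Type*} {H : (ℕ → Fin m) → β} {t : ℕ}
    (hH : ∀ a b : ℕ → Fin m, (∀ s < t, a s = b s) → H a = H b) :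
    ∃ H' : (Finset.range t → Fin m) → β, ∀ a, H a = H' fun s => a s := by
  -- The padding value `0` is irrelevant: `H` only sees indices below `t`.
  refine ⟨fun c => H fun s => if hs : s ∈ Finset.range t then c ⟨s, hs⟩ else 0, fun a => ?_⟩
  refine hH _ _ fun s hs => ?_
  simp [hs]

/-- A finite prefix of indices takes finitely many values, so `H` is bounded and measurable for
free; nothing is asked of the prox procedure. -/
theorem integrable_of_prefix [NeZero m] (hι : ∀ t, Measurable (ι t)) {H : (ℕ → Fin m) → ℝ} {t : ℕ}
    (hH : ∀ a b : ℕ → Fin m, (∀ s < t, a s = b s) → H a = H b) :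
    Integrable (fun w => H fun s => ι s w) P := by
  obtain ⟨H', hH'⟩ := exists_eq_comp_prefix hH
  simp only [hH']
  have hmeas : Measurable fun w => fun s : Finset.range t => ι s w :=
    measurable_pi_lambda _ fun s => hι s
  obtain ⟨C, hC⟩ := (Set.finite_range fun c => ‖H' c‖).bddAbove
  refine Integrable.of_bound ((Measurable.of_discrete (f := H')).comp hmeas).aestronglyMeasurable C
    (Filter.Eventually.of_forall fun w => hC ⟨_, rfl⟩)

/-- The next index is independent of everything determined by the previous ones. -/
theorem integral_next_index [NeZero m] (hι : ∀ t, Measurable (ι t)) (hind : iIndepFun ι P)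
    {p : Fin m → ℝ} {t : ℕ} (hp : ∀ j, P.real (ι t ⁻¹' {j}) = p j)
    {H : (ℕ → Fin m) → Fin m → ℝ}
    (hH : ∀ a b : ℕ → Fin m, (∀ s < t, a s = b s) → H a = H b) :
    ∫ w, H (fun s => ι s w) (ι t w) ∂P = ∫ w, ∑ j, p j * H (fun s => ι s w) j ∂P := by
  have hHj : ∀ j, ∀ a b : ℕ → Fin m, (∀ s < t, a s = b s) → H a j = H b j :=
    fun j a b hab => congrFun (hH a b hab) j
  have hint : ∀ j, Integrable (fun w => H (fun s => ι s w) j) P :=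
    fun j => integrable_of_prefix hι (hHj j)
  -- `Pi.single j 1` evaluated at `ι t w` is the indicator of the event that `j` is drawn,
  -- independent of the prefix.
  have hmul : ∀ j, ∫ w, (Pi.single j 1 : Fin m → ℝ) (ι t w) * H (fun s => ι s w) j ∂P =
      p j * ∫ w, H (fun s => ι s w) j ∂P := fun j => by
    obtain ⟨H', hH'⟩ := exists_eq_comp_prefix (hHj j)
    have hindep := hind.indepFun_finset {t} (Finset.range t) (by simp) hι
    have h2 := hindep.comp
      (φ := fun c : ({t} : Finset ℕ) → Fin m => (Pi.single j 1 : Fin m → ℝ) (c ⟨t, by simp⟩))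
      (ψ := H') (Measurable.of_discrete) (Measurable.of_discrete)
    have hmeas : Measurable fun w => fun s : Finset.range t => ι s w :=
      measurable_pi_lambda _ fun s => hι s
    have h3 := h2.integral_fun_mul_eq_mul_integral
      ((Measurable.of_discrete (f := (Pi.single j 1 : Fin m → ℝ))).comp
        (hι t)).aestronglyMeasurable
      ((Measurable.of_discrete (f := H')).comp hmeas).aestronglyMeasurable
    simp only [Function.comp_def] at h3
    simp only [hH', h3]
    congr 1
    rw [← hp j, ← integral_indicator_one (hι t (measurableSet_singleton j))]
    congr 1
    ext w
    by_cases hw : ι t w = j <;> simp [hw]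
  calc ∫ w, H (fun s => ι s w) (ι t w) ∂P
      = ∫ w, ∑ j, (Pi.single j 1 : Fin m → ℝ) (ι t w) * H (fun s => ι s w) j ∂P := by
        congr 1
        ext w
        simp [Pi.single_apply]
    _ = ∑ j, ∫ w, (Pi.single j 1 : Fin m → ℝ) (ι t w) * H (fun s => ι s w) j ∂P := by
        refine integral_finsetSum _ fun j _ => ?_
        exact integrable_of_prefix (t := t + 1) hι
          (H := fun a => (Pi.single j 1 : Fin m → ℝ) (a t) * H a j) fun a b hab => by
            rw [hab t (by simp), hHj j a b fun s hs => hab s (by omega)]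
    _ = ∑ j, ∫ w, p j * H (fun s => ι s w) j ∂P := by
        simp only [hmul, integral_const_mul]
    _ = _ := (integral_finsetSum _ fun j _ => (hint j).const_mul _).symm

end Sampling

/-! ### Convergence of the method -/

section Convergence

variable {m : ℕ} {E : Type*} [NormedAddCommGroup E] [NormedSpace ℝ E]
  {f : Fin m → E → ℝ} {L p : Fin m → ℝ} {X : Set E} {h ω : E → ℝ} {μ τ η α Λ : ℝ}
  {prox : StrongDual ℝ E → E → StrongDual ℝ E → E × StrongDual ℝ E}
  {x₀ z : E} {s₀ : StrongDual ℝ E}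

theorem run_congr {a b : ℕ → Fin m} {t : ℕ} (hab : ∀ s < t, a s = b s) :
    run f p τ α prox x₀ s₀ a t = run f p τ α prox x₀ s₀ b t := by
  induction t with
  | zero => rfl
  | succ t ih =>
    simp only [run]
    rw [ih fun s hs => hab s (by omega), hab t (by omega)]

theorem output_congr {a b : ℕ → Fin m} {k : ℕ} (hab : ∀ s < k, a s = b s) :
    output f p τ α prox x₀ s₀ a k = output f p τ α prox x₀ s₀ b k := by
  simp only [output]
  congr 1
  refine Finset.sum_congr rfl fun t ht => ?_
  rw [run_congr fun s hs => hab s (by have := (Finset.mem_Icc.1 ht).2; omega)]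

theorem run_isValid (hprox : IsProxMap X h ω μ η prox) (hs : IsSubgradOn ω X x₀ s₀)
    (a : ℕ → Fin m) (t : ℕ) : (run f p τ α prox x₀ s₀ a t).IsValid f ω X := by
  induction t with
  | zero => exact init_isValid hs
  | succ t ih => exact ih.step hprox _

theorem sum_inv_pow_pos {k : ℕ} (hα : 0 < α) (hk : 1 ≤ k) :
    (α ^ k)⁻¹ ≤ ∑ t ∈ Finset.Icc 1 k, (α ^ t)⁻¹ :=
  Finset.single_le_sum (f := fun t => (α ^ t)⁻¹) (fun _ _ => by positivity)
    (Finset.mem_Icc.2 ⟨hk, le_rfl⟩)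

theorem output_mem (hα : 0 < α) (hX : Convex ℝ X) (hprox : IsProxMap X h ω μ η prox)
    (hs : IsSubgradOn ω X x₀ s₀) (a : ℕ → Fin m) {k : ℕ} (hk : 1 ≤ k) :
    output f p τ α prox x₀ s₀ a k ∈ X :=
  hX.centerMass_mem (fun _ _ => by positivity)
    (lt_of_lt_of_le (by positivity) (sum_inv_pow_pos hα hk))
    fun t _ => (run_isValid hprox hs a t).subgrad.1

/-- The objective of the smooth problem. -/
def objective (f : Fin m → E → ℝ) (h ω : E → ℝ) (μ : ℝ) (x : E) : ℝ :=
  (∑ i, f i x) + h x + μ * ω x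

theorem linGap_eq (z x : E) : objective f h ω μ x - objective f h ω μ z =
    linGap f h ω μ z x + ∑ i, bregman (f i) x z := by
  simp only [objective, linGap, bregman, Finset.sum_sub_distrib, sum_apply]
  ring

theorem convexOn_h_add (hμ : 0 < μ) (hh : ConvexOn ℝ X h) (hω : StrongConvexOn X 1 ω) :
    ConvexOn ℝ X fun x => h x + μ * ω x := by
  have hω' : ConvexOn ℝ X ω := hω.convexOn (fun r => by positivity)
  exact hh.add (hω'.smul hμ.le)

/-- This is the first-order optimality condition at the minimizer `z`, with only the smooth part
linearized. -/
theorem linGap_nonneg (hf : ∀ i, IsSmoothConvex (f i) (L i)) (hμ : 0 < μ)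
    (hh : ConvexOn ℝ X h) (hω : StrongConvexOn X 1 ω) (hz : z ∈ X)
    (hmin : IsMinOn (objective f h ω μ) X z) {x : E} (hx : x ∈ X) :
    0 ≤ linGap f h ω μ z x := by
  have := first_order_optimality (f := fun x => ∑ i, f i x) (f' := ∑ i, fderiv ℝ (f i) z)
    (L := ∑ i, L i) hz (fun x => by
      have h1 := Finset.sum_le_sum fun i (_ : i ∈ Finset.univ) => (hf i).upper x z
      simp only [bregman, Finset.sum_sub_distrib, ← Finset.sum_mul, ← Finset.sum_div] at h1
      rw [sum_apply]
      linarith) (convexOn_h_add hμ hh hω) (by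
      have : objective f h ω μ = fun x => ∑ i, f i x + (h x + μ * ω x) := by
        ext x; simp only [objective]; ring
      rwa [this] at hmin) hx
  rw [linGap]
  linarith

/-- A majorant of the objective gap to which Jensen's inequality can be applied along the iterates.
-/
theorem convexOn_linGap_add (hμ : 0 < μ) (hΛ : 0 < Λ) (hh : ConvexOn ℝ X h)
    (hω : StrongConvexOn X 1 ω) :
    ConvexOn ℝ X fun x => linGap f h ω μ z x + Λ / 2 * ‖x - z‖ ^ 2 := by
  have hX := hh.1
  have h1 : ConvexOn ℝ X fun x => (∑ i, fderiv ℝ (f i) z) (x - z) := by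
    refine ⟨hX, fun x _ y _ a b _ _ hab => le_of_eq ?_⟩
    have : a • x + b • y - z = a • (x - z) + b • (y - z) := by
      obtain rfl : b = 1 - a := by linarith
      module
    simp only [this, map_add, map_smul]
  have h2 : ConvexOn ℝ X fun x => ‖x - z‖ := by
    simpa [dist_eq_norm] using convexOn_dist z hX
  have h3 := (h2.pow (fun x _ => norm_nonneg _) 2).smul (c := Λ / 2) (by positivity)
  have h4 := ((h1.add (convexOn_h_add hμ hh hω)).add_const (-(h z + μ * ω z))).add h3
  refine h4.congr fun x _ => ?_
  simp only [Pi.add_apply, linGap, smul_eq_mul, Pi.pow_apply]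
  ring

/-- The gap at the output is a weighted mean of quantities controlled by the potential. -/
theorem objective_output_le (hP : ParamBounds L p μ τ η α Λ)
    (hf : ∀ i, IsSmoothConvex (f i) (L i)) (hL : ∑ i, L i = Λ) (hΛμ : μ ≤ 2 * Λ)
    (hh : ConvexOn ℝ X h) (hω : StrongConvexOn X 1 ω) (hprox : IsProxMap X h ω μ η prox)
    (hs : IsSubgradOn ω X x₀ s₀) (hz : z ∈ X) (hmin : IsMinOn (objective f h ω μ) X z)
    (a : ℕ → Fin m) {k : ℕ} (hk : 1 ≤ k) :
    objective f h ω μ (output f p τ α prox x₀ s₀ a k) - objective f h ω μ z ≤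
      α ^ k * (2 * Λ / μ) * ∑ t ∈ Finset.Icc 1 k, (α ^ t)⁻¹ *
        (linGap f h ω μ z (run f p τ α prox x₀ s₀ a t).x +
          μ / 2 * proxFun ω (run f p τ α prox x₀ s₀ a t).x (run f p τ α prox x₀ s₀ a t).s z) := by
  have hα := hP.α_pos
  have hμ := hP.μ_pos
  set R := run f p τ α prox x₀ s₀ a with hR
  have hval : ∀ t, (R t).IsValid f ω X := run_isValid hprox hs a
  have hquad : ∀ t, 1 / 2 * ‖(R t).x - z‖ ^ 2 ≤ proxFun ω (R t).x (R t).s z := fun t => by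
    rw [norm_sub_rev]
    exact half_sq_norm_le_proxFun hω (hval t).subgrad hz
  have hlin : ∀ t, 0 ≤ linGap f h ω μ z (R t).x := fun t =>
    linGap_nonneg hf hμ hh hω hz hmin (hval t).subgrad.1
  have hterm : ∀ t, linGap f h ω μ z (R t).x + Λ / 2 * ‖(R t).x - z‖ ^ 2 ≤
      2 * Λ / μ * (linGap f h ω μ z (R t).x + μ / 2 * proxFun ω (R t).x (R t).s z) := fun t => by
    have h1 : 1 ≤ 2 * Λ / μ := (one_le_div hμ).2 hΛμ
    have h2 := mul_le_mul_of_nonneg_right h1 (hlin t)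
    have h3 : 2 * Λ / μ * (μ / 2 * proxFun ω (R t).x (R t).s z) =
      Λ * proxFun ω (R t).x (R t).s z := by field_simp
    have h4 := mul_le_mul_of_nonneg_left (hquad t) hP.Λ_pos.le
    rw [mul_add, h3]
    linarith
  have hterm0 : ∀ t, 0 ≤ linGap f h ω μ z (R t).x + μ / 2 * proxFun ω (R t).x (R t).s z :=
    fun t => add_nonneg (hlin t) (mul_nonneg (by positivity)
      ((by positivity : 0 ≤ 1 / 2 * ‖(R t).x - z‖ ^ 2).trans (hquad t)))
  have hθ := sum_inv_pow_pos hα hk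
  have hθ0 : 0 < ∑ t ∈ Finset.Icc 1 k, (α ^ t)⁻¹ := lt_of_lt_of_le (by positivity) hθ
  have hconv := (convexOn_linGap_add (f := f) (z := z) hμ hP.Λ_pos hh hω).map_centerMass_le
    (t := Finset.Icc 1 k) (w := fun t => (α ^ t)⁻¹) (p := fun t => (R t).x)
    (fun _ _ => by positivity) hθ0 (fun t _ => (hval t).subgrad.1)
  have hB : ∀ x, ∑ i, bregman (f i) x z ≤ Λ / 2 * ‖x - z‖ ^ 2 := fun x => by
    refine (Finset.sum_le_sum fun i _ => (hf i).upper x z).trans_eq ?_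
    rw [← Finset.sum_mul, ← Finset.sum_div, hL]
  calc _ ≤ linGap f h ω μ z (output f p τ α prox x₀ s₀ a k) +
        Λ / 2 * ‖output f p τ α prox x₀ s₀ a k - z‖ ^ 2 := by
        rw [linGap_eq]
        exact add_le_add le_rfl (hB _)
    _ ≤ (∑ t ∈ Finset.Icc 1 k, (α ^ t)⁻¹)⁻¹ * ∑ t ∈ Finset.Icc 1 k, (α ^ t)⁻¹ *
        (linGap f h ω μ z (R t).x + Λ / 2 * ‖(R t).x - z‖ ^ 2) := hconv
    _ ≤ (∑ t ∈ Finset.Icc 1 k, (α ^ t)⁻¹)⁻¹ * ∑ t ∈ Finset.Icc 1 k, (α ^ t)⁻¹ *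
        (2 * Λ / μ * (linGap f h ω μ z (R t).x + μ / 2 * proxFun ω (R t).x (R t).s z)) := by
        gcongr with t ht
        exact hterm t
    _ = (∑ t ∈ Finset.Icc 1 k, (α ^ t)⁻¹)⁻¹ * (2 * Λ / μ * ∑ t ∈ Finset.Icc 1 k, (α ^ t)⁻¹ *
        (linGap f h ω μ z (R t).x + μ / 2 * proxFun ω (R t).x (R t).s z)) := by
        rw [Finset.mul_sum (a := 2 * Λ / μ)]
        congr 1
        exact Finset.sum_congr rfl fun t _ => by ring
    _ ≤ α ^ k * (2 * Λ / μ * ∑ t ∈ Finset.Icc 1 k, (α ^ t)⁻¹ *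
        (linGap f h ω μ z (R t).x + μ / 2 * proxFun ω (R t).x (R t).s z)) := by
        refine mul_le_mul_of_nonneg_right ?_ (mul_nonneg ?_ (Finset.sum_nonneg fun t _ =>
          mul_nonneg (by positivity) (hterm0 t)))
        · exact inv_le_of_inv_le₀ (by positivity) hθ
        · have := hP.Λ_pos
          positivity
    _ = _ := by ring

variable {Ω : Type*} [MeasurableSpace Ω] {P : Measure Ω} [IsProbabilityMeasure P]
  {ι : ℕ → Ω → Fin m}

theorem integrable_run [NeZero m] (hι : ∀ t, Measurable (ι t)) (V : State m E → ℝ) (t : ℕ) :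
    Integrable (fun w => V (run f p τ α prox x₀ s₀ (fun s => ι s w) t)) P :=
  integrable_of_prefix hι (H := fun a => V (run f p τ α prox x₀ s₀ a t)) (t := t)
    fun _ _ hab => by rw [run_congr hab]

theorem integrable_output [NeZero m] (hι : ∀ t, Measurable (ι t)) (V : E → ℝ) (k : ℕ) :
    Integrable (fun w => V (output f p τ α prox x₀ s₀ (fun s => ι s w) k)) P :=
  integrable_of_prefix hι (H := fun a => V (output f p τ α prox x₀ s₀ a k)) (t := k)
    fun _ _ hab => by rw [output_congr hab]

/-- The weighted sum of the expected gaps is bounded by the initial potential. -/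
theorem sum_integral_le [NeZero m] (hP : ParamBounds L p μ τ η α Λ)
    (hf : ∀ i, IsSmoothConvex (f i) (L i)) (hω : StrongConvexOn X 1 ω)
    (hprox : IsProxMap X h ω μ η prox) (hs : IsSubgradOn ω X x₀ s₀) (hz : z ∈ X)
    (hι : ∀ t, Measurable (ι t)) (hind : iIndepFun ι P)
    (hp : ∀ t j, P.real (ι t ⁻¹' {j}) = p j) (k : ℕ) :
    ∑ t ∈ Finset.Icc 1 k, (α ^ t)⁻¹ *
        ∫ w, (linGap f h ω μ z (run f p τ α prox x₀ s₀ (fun s => ι s w) t).x +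
          μ / 2 * proxFun ω (run f p τ α prox x₀ s₀ (fun s => ι s w) t).x
            (run f p τ α prox x₀ s₀ (fun s => ι s w) t).s z) ∂P +
      (α ^ k)⁻¹ * ∫ w, potential f p ω μ τ η Λ z
        (run f p τ α prox x₀ s₀ (fun s => ι s w) k) ∂P ≤
      potential f p ω μ τ η Λ z (init f x₀ s₀) := by
  have hα := hP.α_pos
  induction k with
  | zero => simp [run]
  | succ k ih =>
    refine le_trans ?_ ih
    rw [Finset.sum_Icc_succ_top (by omega), add_assoc, ← mul_add,
      ← integral_add (integrable_run (P := P) (f := f) (p := p) (τ := τ) (α := α) (prox := prox)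
        (x₀ := x₀) (s₀ := s₀) hι
        (fun S => linGap f h ω μ z S.x + μ / 2 * proxFun ω S.x S.s z) (k + 1))
        (integrable_run hι _ (k + 1))]
    refine add_le_add le_rfl ?_
    -- Averaging over the fresh index turns the expectation of the new state into the `p`-weighted
    -- sum that contracts.
    have h1 := integral_next_index (P := P) hι hind (hp k) (H := fun a j =>
      linGap f h ω μ z (step f p τ α prox (run f p τ α prox x₀ s₀ a k) j).x +
        μ / 2 * proxFun ω (step f p τ α prox (run f p τ α prox x₀ s₀ a k) j).x
          (step f p τ α prox (run f p τ α prox x₀ s₀ a k) j).s z +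
        potential f p ω μ τ η Λ z (step f p τ α prox (run f p τ α prox x₀ s₀ a k) j))
      fun a b hab => by simp only [run_congr hab]
    have h2 := integral_mono (μ := P) (integrable_run hι (fun S => ∑ j, p j *
        (linGap f h ω μ z (step f p τ α prox S j).x +
        μ / 2 * proxFun ω (step f p τ α prox S j).x (step f p τ α prox S j).s z +
        potential f p ω μ τ η Λ z (step f p τ α prox S j))) k)
      ((integrable_run (f := f) (p := p) (τ := τ) (α := α) (prox := prox)
        (x₀ := x₀) (s₀ := s₀) hι (fun S => potential f p ω μ τ η Λ z S) k).const_mul α)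
      fun w => sum_potential_step_le hP hf hω hprox
        (run_isValid hprox hs (fun s => ι s w) k) hz
    rw [← h1, integral_const_mul] at h2
    calc _ ≤ (α ^ (k + 1))⁻¹ * (α * ∫ w, potential f p ω μ τ η Λ z
        (run f p τ α prox x₀ s₀ (fun s => ι s w) k) ∂P) :=
          mul_le_mul_of_nonneg_left h2 (by positivity)
      _ = _ := by rw [pow_succ]; field_simp

/-- Linear convergence of the expected gap at the output. -/
theorem integral_objective_output_le [NeZero m] (hP : ParamBounds L p μ τ η α Λ)
    (hf : ∀ i, IsSmoothConvex (f i) (L i)) (hL : ∑ i, L i = Λ) (hΛμ : μ ≤ 2 * Λ)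
    (hh : ConvexOn ℝ X h) (hω : StrongConvexOn X 1 ω) (hprox : IsProxMap X h ω μ η prox)
    (hs : IsSubgradOn ω X x₀ s₀) (hz : z ∈ X) (hmin : IsMinOn (objective f h ω μ) X z)
    (hι : ∀ t, Measurable (ι t)) (hind : iIndepFun ι P)
    (hp : ∀ t j, P.real (ι t ⁻¹' {j}) = p j) {k : ℕ} (hk : 1 ≤ k) :
    ∫ w, (objective f h ω μ (output f p τ α prox x₀ s₀ (fun s => ι s w) k) -
        objective f h ω μ z) ∂P ≤
      α ^ k * (2 * Λ / μ) * potential f p ω μ τ η Λ z (init f x₀ s₀) := by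
  have hα := hP.α_pos
  have hμ := hP.μ_pos
  have hΛ := hP.Λ_pos
  have hi : ∀ t ∈ Finset.Icc 1 k, Integrable (fun w => (α ^ t)⁻¹ *
      (linGap f h ω μ z (run f p τ α prox x₀ s₀ (fun s => ι s w) t).x +
        μ / 2 * proxFun ω (run f p τ α prox x₀ s₀ (fun s => ι s w) t).x
          (run f p τ α prox x₀ s₀ (fun s => ι s w) t).s z)) P := fun t _ =>
    integrable_run hι (fun S => (α ^ t)⁻¹ *
      (linGap f h ω μ z S.x + μ / 2 * proxFun ω S.x S.s z)) t
  refine (integral_mono (integrable_output hι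
    (fun x => objective f h ω μ x - objective f h ω μ z) k)
    ((integrable_finsetSum _ hi).const_mul (α ^ k * (2 * Λ / μ))) fun w =>
      objective_output_le hP hf hL hΛμ hh hω hprox hs hz hmin (fun s => ι s w) hk).trans ?_
  rw [integral_const_mul, integral_finsetSum _ hi]
  refine mul_le_mul_of_nonneg_left ?_ (by positivity)
  simp only [integral_const_mul]
  refine le_trans ?_ (sum_integral_le hP hf hω hprox hs hz hι hind hp k)
  exact le_add_of_nonneg_right (mul_nonneg (by positivity) (integral_nonneg fun w =>
    potential_nonneg hP hf hω (run_isValid hprox hs _ k) hz))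

/-- The method starts with `x = xPrev`, so only the prox and Bregman terms survive, and `N` bounds
both of their coefficients. -/
theorem potential_init_le (hP : ParamBounds L p μ τ η α Λ)
    (hf : ∀ i, IsSmoothConvex (f i) (L i)) (hL : ∑ i, L i = Λ) (hL0 : ∀ i, 0 ≤ L i)
    (hω : StrongConvexOn X 1 ω) (hs : IsSubgradOn ω X x₀ s₀) (hz : z ∈ X) {N ΩX : ℝ}
    (hη : μ / 2 + η ≤ N * (μ / 2)) (hN : ∀ i, (1 + τ) / p i ≤ N)
    (hΩ : proxFun ω x₀ s₀ z ≤ ΩX ^ 2) :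
    potential f p ω μ τ η Λ z (init f x₀ s₀) ≤ N * (μ / 2 + Λ) * ΩX ^ 2 := by
  have hquad := half_sq_norm_le_proxFun hω hs hz
  have hprox0 : 0 ≤ proxFun ω x₀ s₀ z := (by positivity : 0 ≤ 1 / 2 * ‖z - x₀‖ ^ 2).trans hquad
  have hN0 : 0 ≤ N := by
    have h1 : 0 < N * (μ / 2) := lt_of_lt_of_le (by linarith [hP.μ_pos, hP.η_nonneg]) hη
    exact (pos_of_mul_pos_left h1 (by linarith [hP.μ_pos])).le
  have hB : ∑ i, (1 + τ) / p i * bregman (f i) x₀ z ≤ N * Λ * proxFun ω x₀ s₀ z := by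
    rw [← hL, Finset.mul_sum, Finset.sum_mul]
    refine Finset.sum_le_sum fun i _ => ?_
    have h1 : bregman (f i) x₀ z ≤ L i * proxFun ω x₀ s₀ z := by
      refine ((hf i).upper x₀ z).trans ?_
      rw [norm_sub_rev]
      have := mul_le_mul_of_nonneg_left hquad (hL0 i)
      linarith
    calc _ ≤ N * (L i * proxFun ω x₀ s₀ z) :=
          mul_le_mul (hN i) h1 ((hf i).nonneg _ _) hN0
      _ = _ := by ring
  have h1 := mul_le_mul_of_nonneg_right hη hprox0
  have h2 : 0 ≤ N * (μ / 2 + Λ) := mul_nonneg hN0 (by linarith [hP.μ_pos, hP.Λ_pos])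
  have h3 := mul_le_mul_of_nonneg_left hΩ h2
  simp only [potential, init, sub_self, map_zero, norm_zero]
  linarith

end Convergence

/-! ### The parameters of the method -/

section Parameters

variable {m : ℕ} {L : Fin m → ℝ} {μ : ℝ}

theorem parRoot_sq {C : ℝ} (hC : 0 ≤ C) :
    parRoot m C ^ 2 = ((m : ℝ) - 1) ^ 2 + 4 * m * C :=
  Real.sq_sqrt (by positivity)

theorem lt_parRoot (hm : 0 < m) {C : ℝ} (hC : 0 < C) : (m : ℝ) - 1 < parRoot m C := by
  refine Real.lt_sqrt_of_sq_lt ?_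
  have : (0 : ℝ) < m := by exact_mod_cast hm
  have : 0 < 4 * m * C := by positivity
  linarith

theorem one_add_parTau (hm : 0 < m) (C : ℝ) :
    1 + parTau m C = (m + 1 + parRoot m C) / (2 * m) := by
  have : (0 : ℝ) < m := by exact_mod_cast hm
  rw [parTau]
  field_simp
  ring

theorem one_div_le_samplingProb (hL : ∀ i, 0 ≤ L i) (i : Fin m) :
    1 / (2 * (m : ℝ)) ≤ samplingProb L i :=
  le_add_of_nonneg_right (div_nonneg (hL i)
    (mul_nonneg zero_le_two (Finset.sum_nonneg fun j _ => hL j)))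

/-- With `N = m + 1 + parRoot m C`, one has `1 - α = 1 / N` and `1 + τ = N / (2 m)`, whose product
`1 / (2 m)` is the uniform half of the sampling probability. The other half gives `L i ≤ 2 * Λ * p
i`. -/
theorem paramBounds (hm : 0 < m) (hμ : 0 < μ) (hL : ∀ i, 0 ≤ L i) (hΛ : 0 < ∑ i, L i) :
    ParamBounds L (samplingProb L) μ (parTau m (8 * (∑ i, L i) / μ))
      (parEta m μ (8 * (∑ i, L i) / μ)) (parAlpha m (8 * (∑ i, L i) / μ)) (∑ i, L i) := by
  have hm1 : (1 : ℝ) ≤ m := by exact_mod_cast hm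
  set Λ := ∑ i, L i with hΛdef
  set C := 8 * Λ / μ with hC
  have hC0 : 0 < C := by positivity
  have hr := lt_parRoot hm hC0
  have hr2 := parRoot_sq (m := m) hC0.le
  have hτ := one_add_parTau hm C
  have hN : 0 < (m : ℝ) + 1 + parRoot m C := by linarith
  have hp := one_div_le_samplingProb hL
  have hNinv : 1 / ((m : ℝ) + 1 + parRoot m C) ≤ 1 / 2 :=
    one_div_le_one_div_of_le two_pos (by linarith)
  have hNinv0 : 0 < 1 / ((m : ℝ) + 1 + parRoot m C) := by positivity
  refine ⟨hΛ, hμ, div_pos (by linarith) (by linarith), ?_, ?_, ?_, fun i => ?_, ?_, fun i => ?_,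
    ?_, ?_, fun i => ?_⟩
  · have : 0 ≤ μ * parRoot m C := mul_nonneg hμ.le (by linarith)
    have : 0 ≤ μ * ((m : ℝ) - 1) := mul_nonneg hμ.le (by linarith)
    rw [parEta]
    linarith
  · rw [parAlpha]; linarith
  · rw [parAlpha]; linarith
  · exact lt_of_lt_of_le (by positivity) (hp i)
  · simp only [samplingProb, Finset.sum_add_distrib, ← Finset.sum_div, ← hΛdef, Finset.sum_const,
      Finset.card_univ, Fintype.card_fin, nsmul_eq_mul]
    field_simp
    norm_num
  · rw [samplingProb, ← hΛdef]
    have : 2 * Λ * (1 / (2 * m) + L i / (2 * Λ)) = Λ / m + L i := by field_simp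
    rw [this]
    exact le_add_of_nonneg_left (by positivity)
  · have : parEta m μ C * parTau m C = μ * (parRoot m C ^ 2 - ((m : ℝ) - 1) ^ 2) / (4 * m) := by
      rw [parEta, parTau]
      field_simp
      ring
    rw [this, hr2, hC]
    field_simp
    ring
  · have h1 : (1 / ((m : ℝ) + 1 + parRoot m C)) * (m + parRoot m C) ≤ 1 := by
      rw [one_div, inv_mul_le_iff₀ hN]; linarith
    have h2 := mul_le_mul_of_nonneg_left h1 (half_pos hμ).le
    rw [parEta, parAlpha]
    linarith
  · refine le_trans (le_of_eq ?_) (hp i)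
    rw [hτ, parAlpha]
    field_simp
    ring

end Parameters

/-! ### Iteration counts -/

/-- A linear rate `1 - 1 / N` reaches a polynomially small accuracy after logarithmically many
steps. -/
theorem pow_le_of_log_le {N R lam : ℝ} (hN : 1 ≤ N) (hR : 2 ≤ R) (hlam : 0 < lam)
    (hlam1 : lam ≤ 1) {k : ℕ} (hk : 16 * N * Real.log (R / lam) ≤ k) :
    352 * (1 - 1 / N) ^ k * R ^ 7 ≤ lam := by
  have hR0 : 0 < R := by linarith
  have hN0 : 0 < N := by linarith
  have h0 : 0 ≤ 1 - 1 / N := sub_nonneg.2 ((div_le_one hN0).2 hN)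
  have h1 : 1 - 1 / N ≤ Real.exp (-(1 / N)) := by
    have := Real.add_one_le_exp (-(1 / N))
    linarith
  have h2 : (1 - 1 / N) ^ k ≤ (lam / R) ^ 16 := by
    calc (1 - 1 / N) ^ k ≤ Real.exp (-(1 / N)) ^ k := pow_le_pow_left₀ h0 h1 k
      _ = Real.exp (-(k / N)) := by rw [← Real.exp_nat_mul]; congr 1; ring
      _ ≤ Real.exp (-(16 * Real.log (R / lam))) := by
        refine Real.exp_le_exp.2 (neg_le_neg ?_)
        rw [le_div_iff₀ hN0]
        linarith
      _ = (lam / R) ^ 16 := by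
        rw [← mul_neg, ← Real.log_inv, inv_div,
          show (16 : ℝ) * Real.log (lam / R) = (16 : ℕ) * Real.log (lam / R) by norm_num,
          Real.exp_nat_mul, Real.exp_log (by positivity)]
  -- The exponent is `16 = 9 + 7`: `352 ≤ 2 ^ 9 ≤ R ^ 9` absorbs the constant.
  calc 352 * (1 - 1 / N) ^ k * R ^ 7 ≤ 2 ^ 9 * (lam / R) ^ 16 * R ^ 7 := by gcongr; norm_num
    _ ≤ R ^ 9 * (lam / R) ^ 16 * R ^ 7 := by gcongr
    _ = lam ^ 16 := by field_simp
    _ ≤ lam := pow_le_of_le_one hlam.le hlam1 (by norm_num)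

/-- Here `178 = 16 * 11 + 2`; the `2` pays for rounding up, since `T * log (R / lam) ≥ 1 / 2`. -/
theorem exists_iteration_count {N R lam T : ℝ} (hN : 1 ≤ N) (hR : 2 ≤ R) (hlam : 0 < lam)
    (hlam1 : lam ≤ 1) (hT : 1 ≤ T) (hNT : N ≤ 11 * T) :
    ∃ K : ℕ, 1 ≤ K ∧ (K : ℝ) ≤ 178 * (T * Real.log (R / lam)) ∧
      ∀ k : ℕ, K ≤ k → 352 * (1 - 1 / N) ^ k * R ^ 7 ≤ lam := by
  have h2 : 2 ≤ R / lam := by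
    rw [le_div_iff₀ hlam]; linarith
  have hlog : 1 / 2 ≤ Real.log (R / lam) := by
    have h3 := Real.log_le_log two_pos h2
    linarith [Real.log_two_gt_d9]
  have hpos : 0 < 16 * N * Real.log (R / lam) := by positivity
  refine ⟨⌈16 * N * Real.log (R / lam)⌉₊, Nat.ceil_pos.2 hpos, ?_, fun k hk => ?_⟩
  · have h4 := (Nat.ceil_lt_add_one hpos.le).le
    have h5 := mul_le_mul_of_nonneg_right hNT (by linarith : 0 ≤ Real.log (R / lam))
    have h6 : 1 * (1 / 2) ≤ T * Real.log (R / lam) :=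
      mul_le_mul hT hlog (by norm_num) (by linarith)
    linarith
  · exact pow_le_of_log_le hN hR hlam hlam1 (Nat.ceil_le.1 hk)

theorem parRoot_bound {m B : ℝ} (hm : 1 ≤ m) (hB0 : 0 ≤ B) (hB : m ≤ B ^ 2) :
    m + 1 + Real.sqrt ((m - 1) ^ 2 + 4 * m * (16 * B ^ 2)) ≤ 11 * (Real.sqrt m * B) := by
  have hs : Real.sqrt m ^ 2 = m := Real.sq_sqrt (by linarith)
  have hs0 : 0 ≤ Real.sqrt m := Real.sqrt_nonneg m
  have hsB : Real.sqrt m ≤ B := Real.sqrt_le_left hB0 |>.2 hB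
  have h1 : m ≤ Real.sqrt m * B := by nlinarith
  have h2 : Real.sqrt ((m - 1) ^ 2 + 4 * m * (16 * B ^ 2)) ≤ 9 * (Real.sqrt m * B) := by
    refine Real.sqrt_le_iff.2 ⟨by positivity, ?_⟩
    have h3 : (m - 1) ^ 2 ≤ (Real.sqrt m * B) ^ 2 := pow_le_pow_left₀ (by linarith) (by linarith) 2
    have h4 : (Real.sqrt m * B) ^ 2 = m * B ^ 2 := by rw [mul_pow, hs]
    have h5 : 0 ≤ m * B ^ 2 := by positivity
    rw [mul_pow, h4]
    linarith
  linarith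

/-- The polynomial factors of the convergence estimate, in terms of `R = m B w` with
`B = ‖A‖ Ω_Y / √(μ ε)` and `w = Ω_X / √(μ ε)`. -/
theorem rate_bound {m B w μ ε : ℝ} (hm : 1 ≤ m) (hB0 : 0 ≤ B) (hB : m ≤ B ^ 2) (hw0 : 0 ≤ w)
    (hw : 1 ≤ m * w ^ 2) (hμ : 0 < μ) (hε : 0 < ε) (hμR : μ ≤ m * B * w) {N : ℝ}
    (hN : N ≤ 11 * (Real.sqrt m * B)) :
    4 * B ^ 2 * (N * (μ / 2 + 2 * B ^ 2 * μ) * (μ * ε * w ^ 2)) ≤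
      176 * (m * B * w) ^ 7 * ε := by
  have hs : Real.sqrt m ^ 2 = m := Real.sq_sqrt (by linarith)
  have hs0 : 0 ≤ Real.sqrt m := Real.sqrt_nonneg m
  have hs1 : Real.sqrt m ≤ m := by rw [Real.sqrt_le_left (by linarith)]; nlinarith
  have hBR : B ≤ m * B * w := by
    have h1 : 1 ≤ m * w := by
      by_contra! hlt
      have : m * w ^ 2 * m < 1 := by
        calc m * w ^ 2 * m = (m * w) ^ 2 := by ring
          _ < 1 := pow_lt_one₀ (by positivity) hlt (by norm_num)
      nlinarith
    nlinarith
  set R := m * B * w with hR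
  have hR0 : 0 ≤ R := by positivity
  have h1 : N * (μ / 2 + 2 * B ^ 2 * μ) ≤ 11 * (m * B) * (4 * B ^ 2 * μ) := by
    refine mul_le_mul (hN.trans (by gcongr)) ?_ (by positivity) (by positivity)
    nlinarith
  calc 4 * B ^ 2 * (N * (μ / 2 + 2 * B ^ 2 * μ) * (μ * ε * w ^ 2))
      ≤ 4 * B ^ 2 * (11 * (m * B) * (4 * B ^ 2 * μ) * (μ * ε * w ^ 2)) := by gcongr
    _ = 176 * (m * w ^ 2 * B ^ 2 * (μ ^ 2 * B ^ 3)) * ε := by ring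
    -- The seventh power collects `m w² B² ≤ R²`, `μ ≤ R` twice and `B ≤ R` three times.
    _ ≤ 176 * (R ^ 2 * (R ^ 2 * R ^ 3)) * ε := by
      have h2 : m * w ^ 2 * B ^ 2 ≤ R ^ 2 := by
        have h3 : R ^ 2 = m * (m * w ^ 2 * B ^ 2) := by rw [hR]; ring
        rw [h3]
        exact le_mul_of_one_le_left (by positivity) hm
      gcongr
    _ = _ := by ring

end RPDG

end

theorem proposition4p2 :
    ∃ c : ℝ, 0 < c ∧
      ∀ (m : ℕ) (E : Type*) [NormedAddCommGroup E] [NormedSpace ℝ E] [FiniteDimensional ℝ E]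
        (F : Fin m → Type*) [∀ i, NormedAddCommGroup (F i)] [∀ i, NormedSpace ℝ (F i)]
        [∀ i, FiniteDimensional ℝ (F i)]
        (D : RPDG.Problem m E F), 0 < m → D.IsAdmissible →
      -- the starting point, the selected subgradient of `ω` there, and `Ω_X`
      ∀ (x₀ : E) (s₀ : StrongDual ℝ E), RPDG.IsSubgradOn D.ω D.X x₀ s₀ →
      ∀ ΩX : ℝ, 0 ≤ ΩX → (∀ x ∈ D.X, RPDG.proxFun D.ω x₀ s₀ x ≤ ΩX ^ 2) →
      -- the accuracy `ε`, small enough in terms of `m, μ, ‖A‖, Ω_X, Ω_Y`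
      ∀ ε : ℝ, 0 < ε →
        ε ≤ (D.normA * D.OmegaY) ^ 2 / (m * D.μ) →
        ε ≤ m * ΩX ^ 2 / D.μ →
        ε ≤ m * D.normA * ΩX * D.OmegaY / (D.μ * max 2 D.μ) →
      -- the minimum that defines the optimal value of the approximation problem is attained
      (∃ x ∈ D.X, IsMinOn (D.PsiSmooth (D.delta ε)) D.X x) →
      ∀ prox : StrongDual ℝ E → E → StrongDual ℝ E → E × StrongDual ℝ E,
        RPDG.IsProxMap D.X D.h D.ω D.μ (RPDG.parEta m D.μ (D.condC ε)) prox →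
      -- the independent random indices `i_1 = ι 0, i_2 = ι 1, …`
      ∀ (S : Type*) [MeasurableSpace S] (P : Measure S) [IsProbabilityMeasure P]
        (ι : ℕ → S → Fin m), (∀ t, Measurable (ι t)) → iIndepFun ι P →
        (∀ t j, P.real (ι t ⁻¹' {j}) = RPDG.samplingProb (D.lip ε) j) →
      (∃ K : ℕ, 1 ≤ K ∧
        (K : ℝ) ≤ c * (D.normA * D.OmegaY * Real.sqrt (m / (D.μ * ε)) *
          Real.log (m * D.normA * ΩX * D.OmegaY / (D.μ * ε))) ∧
        ∀ k : ℕ, K ≤ k →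
          (∀ w, D.xbar ε prox x₀ s₀ (fun t => ι t w) k ∈ D.X) ∧
          Integrable (fun w => D.Psi (D.xbar ε prox x₀ s₀ (fun t => ι t w) k) - D.PsiStar) P ∧
          ∫ w, (D.Psi (D.xbar ε prox x₀ s₀ (fun t => ι t w) k) - D.PsiStar) ∂P ≤ ε) ∧
      (∀ lam : ℝ, 0 < lam → lam < 1 → ∃ K : ℕ, 1 ≤ K ∧
        (K : ℝ) ≤ c * (D.normA * D.OmegaY * Real.sqrt (m / (D.μ * ε)) *
          Real.log (m * D.normA * ΩX * D.OmegaY / (lam * D.μ * ε))) ∧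
        ∀ k : ℕ, K ≤ k →
          (∀ w, D.xbar ε prox x₀ s₀ (fun t => ι t w) k ∈ D.X) ∧
          P.real {w | ε < D.Psi (D.xbar ε prox x₀ s₀ (fun t => ι t w) k) - D.PsiStar} ≤ lam) := by
  refine ⟨178, by norm_num, ?_⟩
  intro m E _ _ _ F _ _ _ D hm hD x₀ s₀ hs ΩX hΩX hΩ ε hε hε1 hε2 hε3 ⟨z, hz, hmin⟩ prox hprox
    S _ P _ ι hι hind hp
  have : NeZero m := ⟨hm.ne'⟩
  have hμ := hD.μ_pos
  have hm1 : (1 : ℝ) ≤ m := by exact_mod_cast hm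
  have hA0 : 0 ≤ D.normA := Real.sqrt_nonneg _
  have hY0 : 0 ≤ D.OmegaY := Real.sqrt_nonneg _
  -- If the product vanished, the first smallness condition would force `ε ≤ 0`.
  have hAY : 0 < D.normA * D.OmegaY := by
    refine lt_of_le_of_ne (mul_nonneg hA0 hY0) fun h0 => ?_
    rw [← h0] at hε1
    norm_num at hε1
    linarith
  have hY : 0 < D.OmegaY := pos_of_mul_pos_right hAY hA0
  have hδ : 0 < D.delta ε := by rw [RPDG.Problem.delta]; positivity
  set q := Real.sqrt (D.μ * ε) with hq
  have hq0 : 0 < q := Real.sqrt_pos.2 (by positivity)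
  have hq2 : q ^ 2 = D.μ * ε := Real.sq_sqrt (by positivity)
  -- In the scaled quantities `B` and `v` the three smallness conditions read `m ≤ B²`, `1 ≤ m v²`
  -- and `max 2 μ ≤ m B v`.
  set B := D.normA * D.OmegaY / q with hBdef
  set v := ΩX / q with hvdef
  have hB0 : 0 ≤ B := by positivity
  have hv0 : 0 ≤ v := by positivity
  have hB : (m : ℝ) ≤ B ^ 2 := by
    rw [hBdef, div_pow, hq2, le_div_iff₀ (by positivity)]
    rw [le_div_iff₀ (by positivity)] at hε1
    linarith
  have hv : 1 ≤ m * v ^ 2 := by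
    rw [hvdef, div_pow, hq2, mul_div_assoc', one_le_div (by positivity)]
    rw [le_div_iff₀ (by positivity)] at hε2
    linarith
  have hReq : m * D.normA * ΩX * D.OmegaY / (D.μ * ε) = m * B * v := by
    rw [hBdef, hvdef, ← hq2]
    field_simp
  have hRmax : max 2 D.μ ≤ m * B * v := by
    rw [← hReq, le_div_iff₀ (by positivity)]
    rw [le_div_iff₀ (by positivity)] at hε3
    linarith
  have hTeq : D.normA * D.OmegaY * Real.sqrt (m / (D.μ * ε)) = Real.sqrt m * B := by
    rw [Real.sqrt_div (by positivity), hBdef, ← hq]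
    ring
  have hlip0 : ∀ i, 0 ≤ D.lip ε i := fun i => by rw [RPDG.Problem.lip]; positivity
  have hsum : ∑ i, D.lip ε i = 2 * B ^ 2 * D.μ := by
    simp only [RPDG.Problem.lip]
    rw [← Finset.sum_div, ← D.normA_sq, RPDG.Problem.delta, hBdef, div_pow, hq2]
    field_simp
  have hBpos : 0 < B ^ 2 := by linarith
  have hΛ : 0 < ∑ i, D.lip ε i := by rw [hsum]; positivity
  have hP := RPDG.paramBounds hm hμ hlip0 hΛ
  have hsmooth := fun i => hD.isSmoothConvex_fSmooth hδ i
  set N : ℝ := m + 1 + RPDG.parRoot m (D.condC ε) with hNdef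
  have hroot0 : 0 ≤ RPDG.parRoot m (D.condC ε) := Real.sqrt_nonneg _
  have hN1 : 1 ≤ N := by linarith
  have hNT : N ≤ 11 * (Real.sqrt m * B) := by
    have h1 := RPDG.parRoot_bound hm1 hB0 hB
    have h2 : D.condC ε = 16 * B ^ 2 := by
      rw [RPDG.Problem.condC, hsum]
      field_simp
      ring
    rw [hNdef, RPDG.parRoot, h2]
    exact h1
  have hT1 : 1 ≤ Real.sqrt m * B := by
    have h1 : 1 ≤ Real.sqrt m := Real.one_le_sqrt.2 hm1
    have h2 : 1 ≤ B := by
      by_contra! hlt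
      have := pow_lt_one₀ hB0 hlt two_ne_zero
      linarith
    nlinarith
  have hgap : ∀ k : ℕ, 1 ≤ k →
      ∫ w, (D.PsiSmooth (D.delta ε) (D.xbar ε prox x₀ s₀ (fun t => ι t w) k) -
        D.PsiSmooth (D.delta ε) z) ∂P ≤ 352 * (1 - 1 / N) ^ k * (m * B * v) ^ 7 * (ε / 2) := by
    intro k hk
    have h1 := RPDG.integral_objective_output_le hP hsmooth rfl
      (by rw [hsum]; nlinarith) hD.convexOn_h hD.strongConvexOn_ω hprox hs hz hmin hι hind hp hk
    have h2 := RPDG.potential_init_le hP hsmooth rfl hlip0 hD.strongConvexOn_ω hs hz (N := N)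
      (by rw [hNdef, RPDG.parEta, RPDG.Problem.condC]; linarith)
      (fun i => by
        rw [div_le_iff₀ (hP.p_pos i), RPDG.one_add_parTau hm]
        calc _ = N * (1 / (2 * m)) := by rw [hNdef, RPDG.Problem.condC]; ring
          _ ≤ _ := mul_le_mul_of_nonneg_left (RPDG.one_div_le_samplingProb hlip0 i)
            (by linarith)) (hΩ z hz)
    have h3 := RPDG.rate_bound hm1 hB0 hB hv0 hv hμ hε ((le_max_right _ _).trans hRmax) hNT
    have hα : RPDG.parAlpha m (8 * (∑ i, D.lip ε i) / D.μ) = 1 - 1 / N := rfl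
    have hΩv : ΩX ^ 2 = D.μ * ε * v ^ 2 := by
      rw [hvdef, div_pow, hq2]
      field_simp
    have hα0 : 0 ≤ 1 - 1 / N := hα ▸ hP.α_pos.le
    have hBB : 2 * (∑ i, D.lip ε i) / D.μ = 4 * B ^ 2 := by
      rw [hsum]
      field_simp
      ring
    rw [hBB, hα] at h1
    rw [hΩv, hsum] at h2
    refine h1.trans ?_
    rw [hsum]
    calc _ ≤ (1 - 1 / N) ^ k * (4 * B ^ 2) * (N * (D.μ / 2 + 2 * B ^ 2 * D.μ) *
          (D.μ * ε * v ^ 2)) := mul_le_mul_of_nonneg_left h2 (by positivity)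
      _ = (1 - 1 / N) ^ k * (4 * B ^ 2 * (N * (D.μ / 2 + 2 * B ^ 2 * D.μ) *
          (D.μ * ε * v ^ 2))) := by ring
      _ ≤ (1 - 1 / N) ^ k * (176 * (m * B * v) ^ 7 * ε) :=
          mul_le_mul_of_nonneg_left h3 (by positivity)
      _ = _ := by ring
  have hmem : ∀ k : ℕ, 1 ≤ k → ∀ w, D.xbar ε prox x₀ s₀ (fun t => ι t w) k ∈ D.X :=
    fun k hk w => RPDG.output_mem hP.α_pos hD.convexOn_h.1 hprox hs _ hk
  have hint : ∀ (k : ℕ) (V : E → ℝ),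
      Integrable (fun w => V (D.xbar ε prox x₀ s₀ (fun t => ι t w) k)) P :=
    fun k V => RPDG.integrable_output hι V k
  have hle : ∀ x, D.Psi x - D.PsiStar ≤
      D.PsiSmooth (D.delta ε) x - D.PsiSmooth (D.delta ε) z + ε / 2 := fun x => by
    have h1 := hD.Psi_sub_PsiStar_le hδ.le hz hmin x
    have h2 : D.delta ε * D.OmegaY ^ 2 = ε / 2 := by
      rw [RPDG.Problem.delta]
      field_simp
    rwa [h2] at h1
  constructor
  -- The bound in expectation is the case `lam = 1` of the count.
  · obtain ⟨K, hK1, hK, hKk⟩ := RPDG.exists_iteration_count hN1 ((le_max_left _ _).trans hRmax)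
      one_pos le_rfl hT1 hNT
    refine ⟨K, hK1, ?_, fun k hk => ⟨hmem k (hK1.trans hk),
      hint k (fun x => D.Psi x - D.PsiStar), ?_⟩⟩
    · rwa [hTeq, hReq, ← div_one (m * B * v)]
    · have h1 := integral_mono (hint k fun x => D.Psi x - D.PsiStar)
        (hint k fun x => D.PsiSmooth (D.delta ε) x - D.PsiSmooth (D.delta ε) z + ε / 2)
        fun w => hle _
      rw [integral_add (hint k fun x => D.PsiSmooth (D.delta ε) x - D.PsiSmooth (D.delta ε) z)
        (integrable_const _)] at h1
      simp only [integral_const, probReal_univ, one_smul] at h1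
      have h2 := hgap k (hK1.trans hk)
      have h3 := mul_le_mul_of_nonneg_right (hKk k hk) (half_pos hε).le
      linarith
  · intro lam hlam hlam1
    obtain ⟨K, hK1, hK, hKk⟩ := RPDG.exists_iteration_count hN1 ((le_max_left _ _).trans hRmax)
      hlam hlam1.le hT1 hNT
    refine ⟨K, hK1, ?_, fun k hk => ⟨hmem k (hK1.trans hk), ?_⟩⟩
    · have h1 : m * D.normA * ΩX * D.OmegaY / (lam * D.μ * ε) = m * B * v / lam := by
        rw [← hReq]
        field_simp
      rwa [hTeq, h1]
    -- Markov's inequality at level `ε / 2`: an original gap above `ε` forces a smoothed gap of at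
    -- least `ε / 2`, whose mean is at most `lam * (ε / 2)`.
    · have h1 := mul_meas_ge_le_integral_of_nonneg (μ := P) (Filter.Eventually.of_forall fun w =>
        sub_nonneg.2 (hmin (hmem k (hK1.trans hk) w)))
        (hint k fun x => D.PsiSmooth (D.delta ε) x - D.PsiSmooth (D.delta ε) z) (ε / 2)
      have h2 := hgap k (hK1.trans hk)
      have h3 := mul_le_mul_of_nonneg_right (hKk k hk) (half_pos hε).le
      have h4 : P.real {w | ε < D.Psi (D.xbar ε prox x₀ s₀ (fun t => ι t w) k) - D.PsiStar} ≤
          P.real {w | ε / 2 ≤ D.PsiSmooth (D.delta ε) (D.xbar ε prox x₀ s₀ (fun t => ι t w) k) -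
            D.PsiSmooth (D.delta ε) z} := by
        refine measureReal_mono fun w hw => ?_
        have h5 := hle (D.xbar ε prox x₀ s₀ (fun t => ι t w) k)
        simp only [Set.mem_ofPred_eq] at hw ⊢
        linarith
      refine h4.trans (le_of_mul_le_mul_left ?_ (half_pos hε))
      linarith
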